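/- **Setting.** We work in continuous first order logic. A continuous signature $\mathcal L$ (possibly many-sorted) has sorts, function symbols and predicate symbols of finite arities, a distinguished binary distance symbol $d$ for each sort, and a continuity modulus $(0,\infty)\to(0,\infty)$ for each argument of each symbol. Formulae are built from atomic formulae with the full system of connectives $\neg x=1-x$, $\frac x2$, $x\dot-y=\max(x-y,0)$ and the quantifiers $\inf$, $\sup$; a theory $T$ is a set of conditions $\varphi=0$ with $\varphi$ a sentence, not necessarily complete. An $\mathcal L$-structure has for each sort a non-empty complete metric space with distances in $[0,1]$, on which function symbols are interpreted by functions and predicate symbols by $[0,1]$-valued functions, all symbols (including $d$) respecting their moduli $\delta$ in each argument: $d(z,w)<\delta(\varepsilon)$ implies that the values differ by at most $\varepsilon$. A model of $T$ is a structure in which the conditions in $T$ hold. $|T|$ denotes the (infinite) number of formulae of the language of $T$, i.e. $\aleph_0$ plus the number of sorts and symbols. **Types.** For a model $M$ and a set $A\subseteq M$, let $T(A)$ be the complete theory of $M$ in the language with constant symbols for the elements of $A$. For a finite tuple of variables $\bar x=x_{<n}$ (of given sorts), $\mathrm S_n(A)$ is the space of complete types over $A$ in $\bar x$, i.e. of types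 $\mathrm{tp}(\bar a/A)$ of tuples $\bar a$ in models of $T(A)$; $\psi^p$ is the value given by the type $p$ to a formula $\psi$ with parameters in $A$. It carries the metric $$d(p,q)=\inf\{\max_{i<n} d(a_i,b_i) : \bar a\models p,\ \bar b\models q\},$$ where $\bar a,\bar b$ range over realisations in common models of $T(A)$. The density character $\|X\|$ of a metric space $X$ is the least cardinality of a dense subset. **Definable predicates.** The forced limit of a sequence $(a_k)_{k<\omega}$ in $[0,1]$ is $\lim_k a'_k$, where $a'_0=a_0$ and $a'_{k+1}$ is the point of $[a'_k-2^{-k-1},a'_k+2^{-k-1}]$ closest to $a_{k+1}$. An $M$-definable predicate is a forced limit of formulae $\chi_k(\bar y)$ with parameters in $M$. **Definitions.** * A formula $\varphi(\bar x,\bar y)$ is stable in $T$ if for no $\varepsilon>0$ is there a model of $T$ with an infinite sequence $(\bar a_i,\bar b_i)_{i<\omega}$ such that $|\varphi(\bar a_i,\bar b_j)-\varphi(\bar a_j,\bar b_i)|\ge\varepsilon$ for all $i<j$. $T$ is stable if all formulae $\varphi(\bar x,\bar y)$ (with $\bar x,\bar y$ finite tuples of variables) are stable in $T$. * A type $p\in\mathrm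 S_n(M)$ over a model $M$ is definable if for every formula $\varphi(x_{<n},\bar y)$ there is an $M$-definable predicate $d_p\varphi(\bar y)$ such that $\varphi(\bar x,\bar b)^p=d_p\varphi(\bar b)$ for all $\bar b$ in $M$. * For a cardinal $\lambda$, $T$ is $\lambda$-stable if $\|\mathrm S_n(A)\|\le\lambda$ for all $n<\omega$ and all sets $A$ with $|A|\le\lambda$ contained in a model of $T$. **Theorem.** The following are equivalent for a theory $T$: 1. $T$ is stable. 2. All types over models of $T$ are definable. 3. $T$ is $\lambda$-stable for all infinite cardinals $\lambda$ such that $\lambda=\lambda^{|T|}$. 4. $T$ is $\lambda$-stable for some cardinal $\lambda\ge|T|$. -/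

import Mathlib

open scoped Topology Cardinal

universe u v

namespace ContLogic

/-! ### Signatures -/

/-- A continuity modulus: a function `(0, ∞) → (0, ∞)` (its values outside `(0, ∞)` are never used). -/
structure Modulus where
  toFun : ℝ → ℝ
  pos : ∀ ε, 0 < ε → 0 < toFun ε

/-- A (metric, possibly many-sorted) continuous signature: sorts, function symbols, predicate
symbols, the arity and sorts of each of them, one distinguished binary distance symbol for
each sort (not listed in `Pr`), and a continuity modulus for each argument of each symbol. -/
structure Signature where
  Srt : Type u
  Fn : Type u
  Pr : Type u
  fnArity : Fn → ℕ
  fnDom : (f : Fn) → Fin (fnArity f) → Srt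
  fnCod : Fn → Srt
  prArity : Pr → ℕ
  prDom : (P : Pr) → Fin (prArity P) → Srt
  fnMod : (f : Fn) → Fin (fnArity f) → Modulus
  prMod : (P : Pr) → Fin (prArity P) → Modulus
  distMod : Srt → Fin 2 → Modulus

/-! ### Syntax -/

/-- Terms whose variables are indexed by `α`, the variable `a` being of sort `σ a`;
`Term L σ s` is the type of terms of sort `s`. -/
inductive Term (L : Signature.{u}) {α : Type v} (σ : α → L.Srt) : L.Srt → Type (max u v)
  | var (a : α) : Term L σ (σ a)
  | app (f : L.Fn) (ts : (i : Fin (L.fnArity f)) → Term L σ (L.fnDom f i)) :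
      Term L σ (L.fnCod f)

/-- Continuous first order formulae, with the full system of connectives `¬ x = 1 - x`,
`x / 2`, `x ∸ y = max (x - y) 0`, and with the quantifiers `inf`, `sup`.
The free variables are indexed by `α` (with sorts `σ`); in addition there are `n` variables
(with sorts `Γ`) in the scope of quantifiers, the innermost one having index `0`. -/
inductive BFormula (L : Signature.{u}) {α : Type v} (σ : α → L.Srt) :
    (n : ℕ) → (Fin n → L.Srt) → Type (max u v)
  | dist {n : ℕ} {Γ : Fin n → L.Srt} (s : L.Srt) (t₁ t₂ : Term L (Sum.elim σ Γ) s) :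
      BFormula L σ n Γ
  | pred {n : ℕ} {Γ : Fin n → L.Srt} (P : L.Pr)
      (ts : (i : Fin (L.prArity P)) → Term L (Sum.elim σ Γ) (L.prDom P i)) : BFormula L σ n Γ
  | neg {n : ℕ} {Γ : Fin n → L.Srt} (φ : BFormula L σ n Γ) : BFormula L σ n Γ
  | half {n : ℕ} {Γ : Fin n → L.Srt} (φ : BFormula L σ n Γ) : BFormula L σ n Γ
  | dotminus {n : ℕ} {Γ : Fin n → L.Srt} (φ ψ : BFormula L σ n Γ) : BFormula L σ n Γ
  | inf {n : ℕ} {Γ : Fin n → L.Srt} (s : L.Srt)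
      (φ : BFormula L σ (n + 1) (Fin.cons s Γ : Fin (n + 1) → L.Srt)) : BFormula L σ n Γ
  | sup {n : ℕ} {Γ : Fin n → L.Srt} (s : L.Srt)
      (φ : BFormula L σ (n + 1) (Fin.cons s Γ : Fin (n + 1) → L.Srt)) : BFormula L σ n Γ

/-- Formulae whose free variables are among variables indexed by `α`, of sorts `σ`. -/
abbrev Formula (L : Signature.{u}) {α : Type v} (σ : α → L.Srt) : Type (max u v) :=
  BFormula L σ 0 (fun i => i.elim0)

/-- Formulae without free variables. -/
abbrev Sentence (L : Signature.{u}) : Type u :=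
  Formula L (fun i : Fin 0 => (i.elim0 : L.Srt))

/-- A theory is a set of sentential conditions `φ = 0`, given by the set of these `φ`. -/
abbrev Theory (L : Signature.{u}) : Type u := Set (Sentence L)

/-- The cardinal `|T|` of a theory in `L`: the number of formulae `φ(x̄, ȳ)` of its language
(with `x̄`, `ȳ` finite tuples of variables), which is always taken to be infinite. -/
noncomputable def Theory.card {L : Signature.{u}} (_T : Theory L) : Cardinal.{u} :=
  max ℵ₀ #(Σ (n : ℕ) (m : ℕ) (Γ : Fin n → L.Srt) (Δ : Fin m → L.Srt), Formula L (Sum.elim Γ Δ))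

/-! ### Structures -/

/-- An `L`-structure: each sort is a non-empty complete metric space with distance in `[0,1]`,
and the symbols are interpreted by functions respecting their continuity moduli in each
argument. -/
structure Struct (L : Signature.{u}) where
  Carrier : L.Srt → Type u
  [metric : ∀ s, MetricSpace (Carrier s)]
  [complete : ∀ s, CompleteSpace (Carrier s)]
  [nonempty : ∀ s, Nonempty (Carrier s)]
  dist_le_one : ∀ (s : L.Srt) (x y : Carrier s), dist x y ≤ 1
  fn : (f : L.Fn) → ((i : Fin (L.fnArity f)) → Carrier (L.fnDom f i)) → Carrier (L.fnCod f)
  pr : (P : L.Pr) → ((i : Fin (L.prArity P)) → Carrier (L.prDom P i)) → ℝ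
  pr_mem : ∀ P a, pr P a ∈ Set.Icc (0 : ℝ) 1
  fn_unif : ∀ (f : L.Fn) (i : Fin (L.fnArity f)) (ε : ℝ), 0 < ε →
    ∀ a b : (j : Fin (L.fnArity f)) → Carrier (L.fnDom f j), (∀ j, j ≠ i → a j = b j) →
      dist (a i) (b i) < (L.fnMod f i).toFun ε → dist (fn f a) (fn f b) ≤ ε
  pr_unif : ∀ (P : L.Pr) (i : Fin (L.prArity P)) (ε : ℝ), 0 < ε →
    ∀ a b : (j : Fin (L.prArity P)) → Carrier (L.prDom P j), (∀ j, j ≠ i → a j = b j) →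
      dist (a i) (b i) < (L.prMod P i).toFun ε → |pr P a - pr P b| ≤ ε
  dist_unif_left : ∀ (s : L.Srt) (ε : ℝ), 0 < ε → ∀ x y z : Carrier s,
    dist x y < (L.distMod s 0).toFun ε → |dist x z - dist y z| ≤ ε
  dist_unif_right : ∀ (s : L.Srt) (ε : ℝ), 0 < ε → ∀ x y z : Carrier s,
    dist x y < (L.distMod s 1).toFun ε → |dist z x - dist z y| ≤ ε

attribute [instance] Struct.metric Struct.complete Struct.nonempty

/-- Tuples of elements of `M`, indexed by `α`, the `a`-th element being of sort `σ a`. -/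
abbrev Struct.Tuple {L : Signature.{u}} (M : Struct L) {α : Type v} (σ : α → L.Srt) :
    Type (max u v) :=
  (a : α) → M.Carrier (σ a)

/-- The concatenation of two tuples. -/
def Struct.join {L : Signature.{u}} (M : Struct L) {α β : Type*} {σ : α → L.Srt}
    {τ : β → L.Srt} (a : M.Tuple σ) (b : M.Tuple τ) : M.Tuple (Sum.elim σ τ)
  | Sum.inl i => a i
  | Sum.inr j => b j

/-- Adding an element `b` in front of a finite tuple. -/
def Struct.cons {L : Signature.{u}} (M : Struct L) {n : ℕ} {Γ : Fin n → L.Srt} {s : L.Srt}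
    (b : M.Carrier s) (w : M.Tuple Γ) : M.Tuple (Fin.cons s Γ : Fin (n + 1) → L.Srt) :=
  Fin.cons (α := fun i => M.Carrier ((Fin.cons s Γ : Fin (n + 1) → L.Srt) i)) b w

/-- The interpretation of a term. -/
def Term.eval {L : Signature.{u}} (M : Struct L) {α : Type v} {σ : α → L.Srt}
    (v : M.Tuple σ) : {s : L.Srt} → Term L σ s → M.Carrier s
  | _, .var a => v a
  | _, .app f ts => M.fn f (fun i => (ts i).eval M v)

/-- The interpretation of a formula; its values are in `[0,1]`, see `BFormula.eval_mem`, so that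
the infima and suprema are over non-empty bounded sets of reals. -/
noncomputable def BFormula.eval {L : Signature.{u}} (M : Struct L) {α : Type v} {σ : α → L.Srt}
    (v : M.Tuple σ) : {n : ℕ} → {Γ : Fin n → L.Srt} → BFormula L σ n Γ → M.Tuple Γ → ℝ
  | _, _, .dist _ t₁ t₂, w => Dist.dist (t₁.eval M (M.join v w)) (t₂.eval M (M.join v w))
  | _, _, .pred P ts, w => M.pr P (fun i => (ts i).eval M (M.join v w))
  | _, _, .neg φ, w => 1 - φ.eval M v w
  | _, _, .half φ, w => φ.eval M v w / 2
  | _, _, .dotminus φ ψ, w => max (φ.eval M v w - ψ.eval M v w) 0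
  | _, _, .inf s φ, w => ⨅ b : M.Carrier s, φ.eval M v (M.cons b w)
  | _, _, .sup s φ, w => ⨆ b : M.Carrier s, φ.eval M v (M.cons b w)

theorem BFormula.eval_mem {L : Signature.{u}} (M : Struct L) {α : Type v} {σ : α → L.Srt}
    (v : M.Tuple σ) {n : ℕ} {Γ : Fin n → L.Srt} (φ : BFormula L σ n Γ) (w : M.Tuple Γ) :
    φ.eval M v w ∈ Set.Icc (0 : ℝ) 1 := by
  induction φ with
  | dist s t₁ t₂ => exact ⟨dist_nonneg, M.dist_le_one s _ _⟩
  | pred P ts => exact M.pr_mem P _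
  | neg φ ih =>
    have h := ih w
    simp only [BFormula.eval, Set.mem_Icc] at h ⊢
    constructor <;> linarith [h.1, h.2]
  | half φ ih =>
    have h := ih w
    simp only [BFormula.eval, Set.mem_Icc] at h ⊢
    constructor <;> linarith [h.1, h.2]
  | dotminus φ ψ ih₁ ih₂ =>
    have h₁ := ih₁ w
    have h₂ := ih₂ w
    simp only [BFormula.eval, Set.mem_Icc] at h₁ h₂ ⊢
    exact ⟨le_max_right _ _, max_le (by linarith [h₁.2, h₂.1]) zero_le_one⟩
  | inf s φ ih =>
    obtain ⟨b⟩ := M.nonempty s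
    exact ⟨le_ciInf fun b => (ih (M.cons b w)).1,
      ciInf_le_of_le ⟨0, by rintro _ ⟨b, rfl⟩; exact (ih (M.cons b w)).1⟩ b (ih (M.cons b w)).2⟩
  | sup s φ ih =>
    obtain ⟨b⟩ := M.nonempty s
    exact ⟨le_ciSup_of_le ⟨1, by rintro _ ⟨b, rfl⟩; exact (ih (M.cons b w)).2⟩ b
      (ih (M.cons b w)).1, ciSup_le fun b => (ih (M.cons b w)).2⟩

/-- The value `φ^M(v)` of a formula. -/
noncomputable def Formula.val {L : Signature.{u}} (M : Struct L) {α : Type v} {σ : α → L.Srt}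
    (φ : Formula L σ) (v : M.Tuple σ) : ℝ :=
  BFormula.eval M v φ (fun i => i.elim0)

/-- `M` is a model of `T`. -/
def Struct.Models {L : Signature.{u}} (M : Struct L) (T : Theory L) : Prop :=
  ∀ φ ∈ T, Formula.val M φ (fun i => i.elim0) = 0

/-! ### Types -/

/-- A family of subsets of the sorts of `M`, that is, a set of elements of `M`. -/
abbrev Struct.Subset {L : Signature.{u}} (M : Struct L) : Type u :=
  (s : L.Srt) → Set (M.Carrier s)

/-- The set of all elements of `M`. -/
def Struct.all {L : Signature.{u}} (M : Struct L) : M.Subset := fun _ => Set.univ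

/-- A formula `φ(x̄, b̄)` with parameters `b̄` in `A`, where the variables `x̄` have sorts `Γ`. -/
structure FormulaOver {L : Signature.{u}} {M : Struct L} (A : M.Subset) {n : ℕ}
    (Γ : Fin n → L.Srt) where
  m : ℕ
  Δ : Fin m → L.Srt
  φ : Formula L (Sum.elim Γ Δ)
  b : (j : Fin m) → A (Δ j)

/-- A model of `T(A)`, the theory of `M` with constant symbols for the elements of `A`: a
structure `N` with an interpretation `c` of these constant symbols, such that all sentences
with parameters in `A` have the same value in `N` as in `M`. -/
structure ModelOver {L : Signature.{u}} {M : Struct L} (A : M.Subset) where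
  N : Struct L
  c : (s : L.Srt) → A s → N.Carrier s
  val_eq : ∀ (m : ℕ) (Δ : Fin m → L.Srt) (φ : Formula L Δ) (b : (j : Fin m) → A (Δ j)),
    φ.val N (fun j => c (Δ j) (b j)) = φ.val M (fun j => (b j : M.Carrier (Δ j)))

/-- The value of a formula with parameters in `A` in a model of `T(A)`. -/
noncomputable def FormulaOver.val {L : Signature.{u}} {M : Struct L} {A : M.Subset} {n : ℕ}
    {Γ : Fin n → L.Srt} (ψ : FormulaOver A Γ) (N : ModelOver A) (a : N.N.Tuple Γ) : ℝ :=
  ψ.φ.val N.N (N.N.join a (fun j => N.c (ψ.Δ j) (ψ.b j)))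

/-- `M` itself, as a model of `T(A)`. -/
def ModelOver.self {L : Signature.{u}} {M : Struct L} (A : M.Subset) : ModelOver A where
  N := M
  c := fun _ a => a
  val_eq := fun _ _ _ _ => rfl

/-- The space of complete types over `A` in variables of sorts `Γ`, that is, the complete types
of tuples in models of `T(A)`. A type `p` is given by the values `ψ^p ∈ [0,1]` of all formulae
`ψ` over `A`; the conditions belonging to `p` are then the `ψ = 0` with `ψ^p = 0`, and they
determine all values since `ψ^p ≤ r` is the condition `ψ ∸ r = 0` for dyadic `r`. -/
def TypeSpace {L : Signature.{u}} {M : Struct L} (A : M.Subset) {n : ℕ}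
    (Γ : Fin n → L.Srt) : Type u :=
  {p : FormulaOver A Γ → ℝ // ∃ (N : ModelOver A) (a : N.N.Tuple Γ), ∀ ψ, p ψ = ψ.val N a}

/-- The tuple `a` in a model of `T(A)` realises the type `p`. -/
def TypeSpace.Realises {L : Signature.{u}} {M : Struct L} {A : M.Subset} {n : ℕ}
    {Γ : Fin n → L.Srt} (p : TypeSpace A Γ) (N : ModelOver A) (a : N.N.Tuple Γ) : Prop :=
  ∀ ψ, p.1 ψ = ψ.val N a

/-- The distance of types: the infimum of `d(a, b)` (the maximum of the distances of the
coordinates) over all realisations `a` of `p` and `b` of `q` in a common model of `T(A)`. -/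
noncomputable def TypeSpace.dist {L : Signature.{u}} {M : Struct L} {A : M.Subset} {n : ℕ}
    {Γ : Fin n → L.Srt} (p q : TypeSpace A Γ) : ℝ :=
  sInf {r : ℝ | ∃ (N : ModelOver A) (a b : N.N.Tuple Γ),
    p.Realises N a ∧ q.Realises N b ∧ r = Dist.dist a b}

/-- The density character of a set `X` with a distance function `d`: the least cardinality
of a dense subset. -/
noncomputable def densityCharacter {X : Type u} (d : X → X → ℝ) : Cardinal.{u} :=
  sInf {κ | ∃ D : Set X, (∀ x, ∀ ε > 0, ∃ y ∈ D, d x y < ε) ∧ κ = #D}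

/-! ### Stability -/

/-- The formula `φ(x̄, ȳ)` is `ε`-stable in `T`. -/
def IsEpsStable {L : Signature.{u}} (T : Theory L) {n m : ℕ} {Γ : Fin n → L.Srt}
    {Δ : Fin m → L.Srt} (φ : Formula L (Sum.elim Γ Δ)) (ε : ℝ) : Prop :=
  ∀ M : Struct L, M.Models T → ¬ ∃ (a : ℕ → M.Tuple Γ) (b : ℕ → M.Tuple Δ),
    ∀ i j, i < j → ε ≤ |φ.val M (M.join (a i) (b j)) - φ.val M (M.join (a j) (b i))|

/-- The formula `φ(x̄, ȳ)` is stable in `T`. -/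
def IsStableFormula {L : Signature.{u}} (T : Theory L) {n m : ℕ} {Γ : Fin n → L.Srt}
    {Δ : Fin m → L.Srt} (φ : Formula L (Sum.elim Γ Δ)) : Prop :=
  ∀ ε : ℝ, 0 < ε → IsEpsStable T φ ε

/-- The theory `T` is stable: all formulae `φ(x̄, ȳ)` are stable in `T`. -/
def Theory.IsStable {L : Signature.{u}} (T : Theory L) : Prop :=
  ∀ (n m : ℕ) (Γ : Fin n → L.Srt) (Δ : Fin m → L.Srt) (φ : Formula L (Sum.elim Γ Δ)),
    IsStableFormula T φ

/-- The theory `T` is `κ`-stable: for every set `A` of at most `κ` elements of a model of `T`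
and every finite tuple of variables, the metric density character of the space of types over
`A` in these variables is at most `κ`. -/
def Theory.IsCardStable {L : Signature.{u}} (T : Theory L) (κ : Cardinal.{u}) : Prop :=
  ∀ M : Struct L, M.Models T → ∀ A : M.Subset, #(Σ s, A s) ≤ κ →
    ∀ (n : ℕ) (Γ : Fin n → L.Srt),
      densityCharacter (TypeSpace.dist : TypeSpace A Γ → TypeSpace A Γ → ℝ) ≤ κ

/-- The modified sequence used for forced limits: `a'₀ = a₀`, and `a'ₙ₊₁` is the point of the
interval `[a'ₙ - 2⁻ⁿ⁻¹, a'ₙ + 2⁻ⁿ⁻¹]` closest to `aₙ₊₁`. -/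
noncomputable def forcedSeq (a : ℕ → ℝ) : ℕ → ℝ
  | 0 => a 0
  | n + 1 => max (forcedSeq a n - (1 / 2) ^ (n + 1))
      (min (a (n + 1)) (forcedSeq a n + (1 / 2) ^ (n + 1)))

/-- `l` is the forced limit of the sequence `a`. -/
def IsForcedLim (a : ℕ → ℝ) (l : ℝ) : Prop :=
  Filter.Tendsto (forcedSeq a) Filter.atTop (𝓝 l)

/-- The formula `φ(x̄, b̄)` over `M`, for `b̄` in `M`. -/
def instanceOver {L : Signature.{u}} {M : Struct L} {n m : ℕ} {Γ : Fin n → L.Srt}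
    {Δ : Fin m → L.Srt} (φ : Formula L (Sum.elim Γ Δ)) (b : M.Tuple Δ) :
    FormulaOver M.all Γ where
  m := m
  Δ := Δ
  φ := φ
  b := fun j => ⟨b j, Set.mem_univ _⟩

/-- A type `p` over a model `M` is definable if for every formula `φ(x̄, ȳ)` there is an
`M`-definable predicate `d_p φ(ȳ)`, i.e., a forced limit of formulae `χₖ(ȳ)` with parameters in
`M`, such that `φ(x̄, b̄)^p = d_p φ(b̄)` for all `b̄` in `M`. -/
def TypeSpace.IsDefinable {L : Signature.{u}} {M : Struct L} {n : ℕ} {Γ : Fin n → L.Srt}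
    (p : TypeSpace M.all Γ) : Prop :=
  ∀ (m : ℕ) (Δ : Fin m → L.Srt) (φ : Formula L (Sum.elim Γ Δ)),
    ∃ χ : ℕ → FormulaOver M.all Δ, ∀ b : M.Tuple Δ,
      IsForcedLim (fun k => (χ k).val (ModelOver.self M.all) b) (p.1 (instanceOver φ b))

end ContLogic

namespace ContLogic

/-! The technical basis is compactness, obtained from metric ultraproducts and Łoś's theorem
(`tendsto_eval_ultra`). Its two main consequences are that every type over `A` is a limit of types
of tuples from any given model of `T(A)` (`exists_ultrafilter_tendsto`), and that configurations
found in arbitrarily large finite size can be realised in infinite size. Stable implies definable.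
For a type `p` over `M` put `f b = φ(x, b)^p`. On finitely many `b` the function `f` is approximated
by `φ(a, ·)` for some `a` in `M`. Pick finitely many `a` in succession, each approximating `f` at
test points determined by the sublists of the earlier ones. If at some `b` too many of the values
`φ(a, b)` fall below `f b - ε`, then those `a` and their test points form a long ladder, and long
ladders contradict stability (`IsStableFormula.exists_no_ladder`). The same holds above `f b + ε`,
by negating `φ`. Hence a median of `2N` values `φ(a, b)` is within `ε` of `f b` for all `b`. The
median is a formula, built from maxima and minima, and approximations with rapidly shrinking error
have `f` as forced limit. Definable implies few types. When `κ = κ ^ |T|`, a set of size at most `κ`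
lies in an elementary substructure of size at most `κ`. Types over the set extend to types over this
model. A definable type is determined by its family of definitions, and there are at most `(κ ^ ℵ₀)
^ |T| = κ` such families. The cardinal `2 ^ |T|` satisfies the hypothesis. Few types implies stable.
An instability pattern can be thinned so that `φ(a_i, b_j)` is close to one constant for `i < j` and
to another, well separated from it, for `i > j`; compactness then stretches it along any linear
order. In the order built from a binary tree with more than `κ` branches but at most `κ` nodes
(`exists_linearOrder_separating`), the branches give more than `κ` types over the parameters at the
nodes. Formulae are uniformly continuous, so these types stay a fixed distance apart and no dense
set has size at most `κ`. -/

/-! ### Substitution -/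

/-- Simultaneous substitution of terms for the variables of a term. -/
def Term.subst {L : Signature.{u}} {α β : Type*} {σ : α → L.Srt} {τ : β → L.Srt}
    (ρ : ∀ a, Term L τ (σ a)) : {s : L.Srt} → Term L σ s → Term L τ s
  | _, .var a => ρ a
  | _, .app f ts => .app f (fun i => (ts i).subst ρ)

theorem Term.eval_subst {L : Signature.{u}} {α β : Type*} {σ : α → L.Srt} {τ : β → L.Srt}
    (M : Struct L) (ρ : ∀ a, Term L τ (σ a)) {s : L.Srt} (t : Term L σ s) (v : M.Tuple τ) :
    (t.subst ρ).eval M v = t.eval M (fun a => (ρ a).eval M v) := by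
  induction t with
  | var a => rfl
  | app f ts ih => simp only [Term.subst, Term.eval, ih]

/-- The variables of a context, seen in the context with one more bound variable. -/
def shiftVar {L : Signature.{u}} {β : Type*} {τ : β → L.Srt} {n : ℕ} {Γ : Fin n → L.Srt}
    (s : L.Srt) : ∀ x : β ⊕ Fin n,
      Term L (Sum.elim τ (Fin.cons s Γ : Fin (n + 1) → L.Srt)) (Sum.elim τ Γ x)
  | .inl b => .var (σ := Sum.elim τ (Fin.cons s Γ : Fin (n + 1) → L.Srt)) (.inl b)
  | .inr i => .var (σ := Sum.elim τ (Fin.cons s Γ : Fin (n + 1) → L.Srt)) (.inr i.succ)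

/-- The substitution under a quantifier induced by a substitution. -/
def liftSubst {L : Signature.{u}} {α β : Type*} {σ : α → L.Srt} {τ : β → L.Srt} {n n' : ℕ}
    {Γ : Fin n → L.Srt} {Γ' : Fin n' → L.Srt} (s : L.Srt)
    (ρ : ∀ x, Term L (Sum.elim τ Γ') (Sum.elim σ Γ x)) : ∀ x : α ⊕ Fin (n + 1),
      Term L (Sum.elim τ (Fin.cons s Γ' : Fin (n' + 1) → L.Srt))
        (Sum.elim σ (Fin.cons s Γ : Fin (n + 1) → L.Srt) x)
  | .inl a => (ρ (.inl a)).subst (shiftVar s)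
  | .inr i => Fin.cases
      (motive := fun i => Term L (Sum.elim τ (Fin.cons s Γ' : Fin (n' + 1) → L.Srt))
        ((Fin.cons s Γ : Fin (n + 1) → L.Srt) i))
      (Term.var (σ := Sum.elim τ (Fin.cons s Γ' : Fin (n' + 1) → L.Srt)) (.inr 0))
      (fun i => (ρ (.inr i)).subst (shiftVar s)) i

/-- Substitution of terms for the free variables and the variables `Γ` of a formula. -/
def BFormula.subst {L : Signature.{u}} {α β : Type*} {σ : α → L.Srt} {τ : β → L.Srt} :
    {n : ℕ} → {Γ : Fin n → L.Srt} → BFormula L σ n Γ → {n' : ℕ} → {Γ' : Fin n' → L.Srt} →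
    (∀ x, Term L (Sum.elim τ Γ') (Sum.elim σ Γ x)) → BFormula L τ n' Γ'
  | _, _, .dist s t₁ t₂, _, _, ρ => .dist s (t₁.subst ρ) (t₂.subst ρ)
  | _, _, .pred P ts, _, _, ρ => .pred P (fun i => (ts i).subst ρ)
  | _, _, .neg φ, _, _, ρ => .neg (φ.subst ρ)
  | _, _, .half φ, _, _, ρ => .half (φ.subst ρ)
  | _, _, .dotminus φ ψ, _, _, ρ => .dotminus (φ.subst ρ) (ψ.subst ρ)
  | _, _, .inf s φ, _, _, ρ => .inf s (φ.subst (liftSubst s ρ))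
  | _, _, .sup s φ, _, _, ρ => .sup s (φ.subst (liftSubst s ρ))

theorem eval_shiftVar {L : Signature.{u}} {β : Type*} {τ : β → L.Srt} {n : ℕ}
    {Γ : Fin n → L.Srt} {s : L.Srt} (M : Struct L) (v : M.Tuple τ) (w : M.Tuple Γ)
    (b : M.Carrier s) :
    (fun x => (shiftVar s x).eval M (M.join v (M.cons b w))) = M.join v w := by
  funext x
  rcases x with x | i <;> rfl

theorem eval_liftSubst {L : Signature.{u}} {α β : Type*} {σ : α → L.Srt} {τ : β → L.Srt}
    {n n' : ℕ} {Γ : Fin n → L.Srt} {Γ' : Fin n' → L.Srt} {s : L.Srt} (M : Struct L)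
    {ρ : ∀ x, Term L (Sum.elim τ Γ') (Sum.elim σ Γ x)} {v : M.Tuple σ} {w : M.Tuple Γ}
    {v' : M.Tuple τ} {w' : M.Tuple Γ'}
    (h : ∀ x, (ρ x).eval M (M.join v' w') = M.join v w x) (b : M.Carrier s) (x) :
    (liftSubst s ρ x).eval M (M.join v' (M.cons b w')) = M.join v (M.cons b w) x := by
  rcases x with a | i
  · exact (Term.eval_subst _ _ _ _).trans
      ((congrArg (fun u => (ρ (.inl a)).eval M u) (eval_shiftVar M v' w' b)).trans (h _))
  · induction i using Fin.cases with
    | zero => rfl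
    | succ i =>
      exact (Term.eval_subst _ _ _ _).trans
        ((congrArg (fun u => (ρ (.inr i)).eval M u) (eval_shiftVar M v' w' b)).trans (h _))

/-- The two assignments are linked only by the pointwise hypothesis `h`. It passes under quantifiers
by `eval_liftSubst`, and no equation between dependent tuples has to be rewritten. -/
theorem BFormula.eval_subst {L : Signature.{u}} {α β : Type*} {σ : α → L.Srt} {τ : β → L.Srt}
    (M : Struct L) {n : ℕ} {Γ : Fin n → L.Srt} (φ : BFormula L σ n Γ) {n' : ℕ}
    {Γ' : Fin n' → L.Srt} (ρ : ∀ x, Term L (Sum.elim τ Γ') (Sum.elim σ Γ x)) {v : M.Tuple σ}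
    {w : M.Tuple Γ} {v' : M.Tuple τ} {w' : M.Tuple Γ'}
    (h : ∀ x, (ρ x).eval M (M.join v' w') = M.join v w x) :
    (φ.subst ρ).eval M v' w' = φ.eval M v w := by
  induction φ generalizing n' with
  | dist s t₁ t₂ => simp only [BFormula.subst, BFormula.eval, Term.eval_subst, h]
  | pred P ts => simp only [BFormula.subst, BFormula.eval, Term.eval_subst, h]
  | neg φ ih => simp only [BFormula.subst, BFormula.eval, ih ρ h]
  | half φ ih => simp only [BFormula.subst, BFormula.eval, ih ρ h]
  | dotminus φ ψ ih₁ ih₂ => simp only [BFormula.subst, BFormula.eval, ih₁ ρ h, ih₂ ρ h]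
  | inf s φ ih =>
    simp only [BFormula.subst, BFormula.eval]
    exact iInf_congr fun b => ih _ (eval_liftSubst M h b)
  | sup s φ ih =>
    simp only [BFormula.subst, BFormula.eval]
    exact iSup_congr fun b => ih _ (eval_liftSubst M h b)

/-- The formula `φ(x̄, ȳ)`, with the variables `x̄` made available for quantification. -/
def Formula.bind {L : Signature.{u}} {α : Type*} {σ : α → L.Srt} {n : ℕ} {Γ : Fin n → L.Srt}
    (φ : Formula L (Sum.elim Γ σ)) : BFormula L σ n Γ :=
  φ.subst fun
    | .inl (.inl i) => .var (σ := Sum.elim σ Γ) (.inr i)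
    | .inl (.inr a) => .var (σ := Sum.elim σ Γ) (.inl a)
    | .inr i => i.elim0

theorem Formula.eval_bind {L : Signature.{u}} {α : Type*} {σ : α → L.Srt} {n : ℕ}
    {Γ : Fin n → L.Srt} (φ : Formula L (Sum.elim Γ σ)) (M : Struct L) (v : M.Tuple σ)
    (w : M.Tuple Γ) : φ.bind.eval M v w = φ.val M (M.join w v) := by
  refine BFormula.eval_subst M φ _ ?_
  rintro ((i | a) | i)
  · rfl
  · rfl
  · exact i.elim0

/-- The formula obtained by turning the variables `Γ` into free variables. -/
def BFormula.free {L : Signature.{u}} {α : Type*} {σ : α → L.Srt} {n : ℕ} {Γ : Fin n → L.Srt}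
    (φ : BFormula L σ n Γ) : Formula L (Sum.elim Γ σ) :=
  φ.subst fun
    | .inl a => .var (σ := Sum.elim (Sum.elim Γ σ) _) (.inl (.inr a))
    | .inr i => .var (σ := Sum.elim (Sum.elim Γ σ) _) (.inl (.inl i))

theorem BFormula.val_free {L : Signature.{u}} {α : Type*} {σ : α → L.Srt} {n : ℕ}
    {Γ : Fin n → L.Srt} (φ : BFormula L σ n Γ) (M : Struct L) (v : M.Tuple σ)
    (w : M.Tuple Γ) : φ.free.val M (M.join w v) = φ.eval M v w := by
  refine BFormula.eval_subst M φ _ ?_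
  rintro (a | i) <;> rfl

/-- Substitution of variables for the free variables of a formula. -/
def BFormula.rename {L : Signature.{u}} {α β : Type*} {σ : α → L.Srt} {τ : β → L.Srt} {n : ℕ}
    {Γ : Fin n → L.Srt} (φ : BFormula L σ n Γ) (ρ : ∀ a, Term L τ (σ a)) : BFormula L τ n Γ :=
  φ.subst fun
    | .inl a => (ρ a).subst fun b => .var (σ := Sum.elim τ Γ) (.inl b)
    | .inr i => .var (σ := Sum.elim τ Γ) (.inr i)

theorem BFormula.eval_rename {L : Signature.{u}} {α β : Type*} {σ : α → L.Srt} {τ : β → L.Srt}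
    {n : ℕ} {Γ : Fin n → L.Srt} (φ : BFormula L σ n Γ) (ρ : ∀ a, Term L τ (σ a)) (M : Struct L)
    (v : M.Tuple τ) (w : M.Tuple Γ) :
    (φ.rename ρ).eval M v w = φ.eval M (fun a => (ρ a).eval M v) w := by
  refine BFormula.eval_subst M φ _ ?_
  rintro (a | i)
  · exact Term.eval_subst _ _ _ _
  · rfl

/-! ### Finite supports -/

/-- Asking for all lists `l` containing `l₀`, and not just `l₀`, lets several subterms be rewritten
over one common list of variables. -/
theorem Term.exists_finite_support {L : Signature.{u}} {α : Type*} {σ : α → L.Srt} {n : ℕ}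
    {Γ : Fin n → L.Srt} {s : L.Srt} (t : Term L (Sum.elim σ Γ) s) :
    ∃ l₀ : List α, ∀ l : List α, l₀ ⊆ l →
      ∃ t' : Term L (Sum.elim (fun j : Fin l.length => σ (l.get j)) Γ) s,
        ∀ (M : Struct L) (v : M.Tuple σ) (w : M.Tuple Γ),
          t'.eval M (M.join (fun j => v (l.get j)) w) = t.eval M (M.join v w) := by
  induction t with
  | var x =>
    rcases x with a | i
    · refine ⟨[a], fun l hl => ?_⟩
      obtain ⟨j, rfl⟩ := List.get_of_mem (hl (List.mem_singleton_self a))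
      exact ⟨.var (σ := Sum.elim (fun j : Fin l.length => σ (l.get j)) Γ) (.inl j),
        fun M v w => rfl⟩
    · exact ⟨[], fun l _ => ⟨.var (σ := Sum.elim _ Γ) (.inr i), fun M v w => rfl⟩⟩
  | app f ts ih =>
    choose l₀ h using ih
    refine ⟨(List.finRange _).flatMap l₀, fun l hl => ?_⟩
    have hl' : ∀ i, l₀ i ⊆ l := fun i x hx =>
      hl (List.mem_flatMap.2 ⟨i, List.mem_finRange i, hx⟩)
    choose t' ht' using fun i => h i l (hl' i)
    exact ⟨.app f t', fun M v w => by simp only [Term.eval, ht']⟩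

theorem BFormula.exists_finite_support {L : Signature.{u}} {α : Type*} {σ : α → L.Srt} {n : ℕ}
    {Γ : Fin n → L.Srt} (φ : BFormula L σ n Γ) :
    ∃ l₀ : List α, ∀ l : List α, l₀ ⊆ l →
      ∃ φ' : BFormula L (fun j : Fin l.length => σ (l.get j)) n Γ,
        ∀ (M : Struct L) (v : M.Tuple σ) (w : M.Tuple Γ),
          φ'.eval M (fun j => v (l.get j)) w = φ.eval M v w := by
  induction φ with
  | dist s t₁ t₂ =>
    obtain ⟨l₁, h₁⟩ := t₁.exists_finite_support
    obtain ⟨l₂, h₂⟩ := t₂.exists_finite_support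
    refine ⟨l₁ ++ l₂, fun l hl => ?_⟩
    obtain ⟨h3, h4⟩ := List.append_subset.1 hl
    obtain ⟨t₁', h₁'⟩ := h₁ l h3
    obtain ⟨t₂', h₂'⟩ := h₂ l h4
    exact ⟨.dist s t₁' t₂', fun M v w => by simp only [BFormula.eval, h₁', h₂']⟩
  | pred P ts =>
    choose l₀ h using fun i => (ts i).exists_finite_support
    refine ⟨(List.finRange _).flatMap l₀, fun l hl => ?_⟩
    have hl' : ∀ i, l₀ i ⊆ l := fun i x hx =>
      hl (List.mem_flatMap.2 ⟨i, List.mem_finRange i, hx⟩)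
    choose t' ht' using fun i => h i l (hl' i)
    exact ⟨.pred P t', fun M v w => by simp only [BFormula.eval, ht']⟩
  | neg φ ih =>
    obtain ⟨l₀, h⟩ := ih
    refine ⟨l₀, fun l hl => ?_⟩
    obtain ⟨φ', h'⟩ := h l hl
    exact ⟨.neg φ', fun M v w => by simp only [BFormula.eval, h']⟩
  | half φ ih =>
    obtain ⟨l₀, h⟩ := ih
    refine ⟨l₀, fun l hl => ?_⟩
    obtain ⟨φ', h'⟩ := h l hl
    exact ⟨.half φ', fun M v w => by simp only [BFormula.eval, h']⟩
  | dotminus φ ψ ih₁ ih₂ =>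
    obtain ⟨l₁, h₁⟩ := ih₁
    obtain ⟨l₂, h₂⟩ := ih₂
    refine ⟨l₁ ++ l₂, fun l hl => ?_⟩
    obtain ⟨h3, h4⟩ := List.append_subset.1 hl
    obtain ⟨t₁', h₁'⟩ := h₁ l h3
    obtain ⟨t₂', h₂'⟩ := h₂ l h4
    exact ⟨.dotminus t₁' t₂', fun M v w => by simp only [BFormula.eval, h₁', h₂']⟩
  | inf s φ ih =>
    obtain ⟨l₀, h⟩ := ih
    refine ⟨l₀, fun l hl => ?_⟩
    obtain ⟨φ', h'⟩ := h l hl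
    exact ⟨.inf s φ', fun M v w => by simp only [BFormula.eval, h']⟩
  | sup s φ ih =>
    obtain ⟨l₀, h⟩ := ih
    refine ⟨l₀, fun l hl => ?_⟩
    obtain ⟨φ', h'⟩ := h l hl
    exact ⟨.sup s φ', fun M v w => by simp only [BFormula.eval, h']⟩

/-- Every formula has only finitely many free variables. -/
theorem BFormula.exists_fin {L : Signature.{u}} {α : Type*} {σ : α → L.Srt} {n : ℕ}
    {Γ : Fin n → L.Srt} (φ : BFormula L σ n Γ) :
    ∃ (m : ℕ) (e : Fin m → α) (φ' : BFormula L (fun j => σ (e j)) n Γ),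
      ∀ (M : Struct L) (v : M.Tuple σ) (w : M.Tuple Γ),
        φ'.eval M (fun j => v (e j)) w = φ.eval M v w := by
  obtain ⟨l, h⟩ := φ.exists_finite_support
  obtain ⟨φ', h'⟩ := h l (List.Subset.refl l)
  exact ⟨l.length, l.get, φ', h'⟩

/-! ### Quantification over tuples, and constants -/

theorem exists_infAll {L : Signature.{u}} {α : Type*} {σ : α → L.Srt} {n : ℕ}
    {Γ : Fin n → L.Srt} (φ : BFormula L σ n Γ) :
    ∃ χ : Formula L σ, ∀ (M : Struct L) (v : M.Tuple σ),
      (∀ w : M.Tuple Γ, χ.val M v ≤ φ.eval M v w) ∧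
      ∀ r, χ.val M v < r → ∃ w : M.Tuple Γ, φ.eval M v w < r := by
  induction n with
  | zero =>
    -- `Γ` is not definitionally the empty context used in `Formula`, so a substitution transports
    -- `φ`.
    let ρ : ∀ x, Term L (Sum.elim σ (fun i : Fin 0 => (i.elim0 : L.Srt))) (Sum.elim σ Γ x) := fun
      | .inl a => .var (σ := Sum.elim σ (fun i : Fin 0 => (i.elim0 : L.Srt))) (.inl a)
      | .inr i => i.elim0
    have key : ∀ (M : Struct L) (v : M.Tuple σ) (w : M.Tuple Γ),
        Formula.val M (φ.subst ρ : Formula L σ) v = φ.eval M v w := by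
      intro M v w
      refine BFormula.eval_subst M φ ρ ?_
      rintro (a | i)
      · rfl
      · exact i.elim0
    refine ⟨φ.subst ρ, fun M v => ⟨fun w => (key M v w).le, fun r hr => ?_⟩⟩
    exact ⟨fun i => i.elim0, by rwa [← key]⟩
  | succ n ih =>
    let ρ : ∀ x, Term L (Sum.elim σ (Fin.cons (Γ 0) (Fin.tail Γ) : Fin (n + 1) → L.Srt))
        (Sum.elim σ Γ x) := fun
      | .inl a => .var (σ := Sum.elim σ (Fin.cons (Γ 0) (Fin.tail Γ) : Fin (n + 1) → L.Srt))
          (.inl a)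
      | .inr i => Fin.cases (motive := fun i => Term L (Sum.elim σ
            (Fin.cons (Γ 0) (Fin.tail Γ) : Fin (n + 1) → L.Srt)) (Γ i))
          (Term.var (σ := Sum.elim σ (Fin.cons (Γ 0) (Fin.tail Γ) : Fin (n + 1) → L.Srt))
            (.inr 0))
          (fun i => Term.var
            (σ := Sum.elim σ (Fin.cons (Γ 0) (Fin.tail Γ) : Fin (n + 1) → L.Srt))
            (.inr i.succ)) i
    obtain ⟨χ, hχ⟩ := ih (.inf (Γ 0) (φ.subst ρ))
    have key : ∀ (M : Struct L) (v : M.Tuple σ) (w : M.Tuple Γ),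
        (φ.subst ρ).eval M v (M.cons (w 0) (fun i => w i.succ)) = φ.eval M v w := by
      intro M v w
      refine BFormula.eval_subst M φ ρ ?_
      rintro (a | i)
      · rfl
      · induction i using Fin.cases <;> rfl
    refine ⟨χ, fun M v => ⟨fun w => ?_, fun r hr => ?_⟩⟩
    · refine ((hχ M v).1 (fun i => w i.succ)).trans ?_
      rw [← key]
      exact ciInf_le (f := fun b => (φ.subst ρ).eval M v (M.cons b (fun i => w i.succ)))
        ⟨0, by rintro _ ⟨b, rfl⟩; exact (BFormula.eval_mem _ _ _ _).1⟩ (w 0)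
    · obtain ⟨w, hw⟩ := (hχ M v).2 r hr
      obtain ⟨b, hb⟩ := exists_lt_of_ciInf_lt hw
      refine ⟨Fin.cons (α := fun i => M.Carrier (Γ i)) b w, ?_⟩
      rw [← key]
      exact hb

/-- Given one formula, constants are, up to any `ε`, values of formulae. -/
theorem BFormula.exists_const {L : Signature.{u}} {α : Type*} {σ : α → L.Srt} {n : ℕ}
    {Γ : Fin n → L.Srt} (φ : BFormula L σ n Γ) {r : ℝ} (hr : r ∈ Set.Icc (0 : ℝ) 1) {ε : ℝ}
    (hε : 0 < ε) :
    ∃ (χ : BFormula L σ n Γ) (q : ℝ), q ≤ r ∧ r ≤ q + ε ∧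
      ∀ (M : Struct L) (v : M.Tuple σ) (w : M.Tuple Γ), χ.eval M v w = q := by
  -- The constant `1` is `¬(φ ∸ φ)`, and halving gives `2⁻ᵏ`. Multiples then arise from truncated
  -- addition `¬(¬χ ∸ ψ) = min (χ + ψ) 1`.
  have unit : ∀ k : ℕ, ∃ χ : BFormula L σ n Γ, ∀ (M : Struct L) (v : M.Tuple σ)
      (w : M.Tuple Γ), χ.eval M v w = (1 / 2) ^ k := by
    intro k
    induction k with
    | zero => exact ⟨.neg (.dotminus φ φ), fun M v w => by simp [BFormula.eval]⟩
    | succ k ih =>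
      obtain ⟨χ, h⟩ := ih
      exact ⟨.half χ, fun M v w => by simp only [BFormula.eval, h]; ring⟩
  have mult : ∀ k l : ℕ, ∃ χ : BFormula L σ n Γ, ∀ (M : Struct L) (v : M.Tuple σ)
      (w : M.Tuple Γ), χ.eval M v w = min ((l : ℝ) * (1 / 2) ^ k) 1 := by
    intro k l
    obtain ⟨ψ, hψ⟩ := unit k
    induction l with
    | zero => exact ⟨.dotminus φ φ, fun M v w => by simp [BFormula.eval]⟩
    | succ l ih =>
      obtain ⟨χ, h⟩ := ih
      refine ⟨.neg (.dotminus (.neg χ) ψ), fun M v w => ?_⟩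
      simp only [BFormula.eval, h, hψ, Nat.cast_add, Nat.cast_one, add_mul, one_mul]
      have : (0 : ℝ) < (1 / 2) ^ k := by positivity
      rcases le_total ((l : ℝ) * (1 / 2) ^ k) 1 with h1 | h1
      · rw [min_eq_left h1]
        rcases le_total (1 - (l : ℝ) * (1 / 2) ^ k - (1 / 2) ^ k) 0 with h2 | h2
        · rw [max_eq_right h2, min_eq_right (by linarith)]; ring
        · rw [max_eq_left h2, min_eq_left (by linarith)]; ring
      · rw [min_eq_right h1, max_eq_right (by linarith), min_eq_right (by linarith)]; ring
  obtain ⟨k, hk⟩ := exists_pow_lt_of_lt_one hε (by norm_num : (1 / 2 : ℝ) < 1)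
  obtain ⟨χ, h⟩ := mult k ⌊r * 2 ^ k⌋₊
  have h2 : (2 : ℝ) ^ k * (1 / 2) ^ k = 1 := by rw [← mul_pow]; norm_num
  have hpos : (0 : ℝ) < (1 / 2) ^ k := by positivity
  have h3 := Nat.floor_le (show 0 ≤ r * 2 ^ k by have := hr.1; positivity)
  have h4 := Nat.lt_floor_add_one (r * 2 ^ k)
  have h5 : (⌊r * 2 ^ k⌋₊ : ℝ) * (1 / 2) ^ k ≤ r := by
    calc _ ≤ r * 2 ^ k * (1 / 2) ^ k := by gcongr
      _ = r := by rw [mul_assoc, h2, mul_one]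
  have h6 : r ≤ (⌊r * 2 ^ k⌋₊ : ℝ) * (1 / 2) ^ k + ε := by
    calc r = r * 2 ^ k * (1 / 2) ^ k := by rw [mul_assoc, h2, mul_one]
      _ ≤ (⌊r * 2 ^ k⌋₊ + 1 : ℝ) * (1 / 2) ^ k := by gcongr
      _ ≤ _ := by linarith
  refine ⟨χ, (⌊r * 2 ^ k⌋₊ : ℝ) * (1 / 2) ^ k, h5, h6, fun M v w => ?_⟩
  rw [h, min_eq_left (h5.trans hr.2)]

/-- The minimum of two formulae. -/
def BFormula.min {L : Signature.{u}} {α : Type*} {σ : α → L.Srt} {n : ℕ} {Γ : Fin n → L.Srt}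
    (φ ψ : BFormula L σ n Γ) : BFormula L σ n Γ :=
  .dotminus φ (.dotminus φ ψ)

theorem BFormula.eval_min {L : Signature.{u}} {α : Type*} {σ : α → L.Srt} {n : ℕ}
    {Γ : Fin n → L.Srt} (φ ψ : BFormula L σ n Γ) (M : Struct L) (v : M.Tuple σ)
    (w : M.Tuple Γ) : (φ.min ψ).eval M v w = Min.min (φ.eval M v w) (ψ.eval M v w) := by
  have h1 := φ.eval_mem M v w
  have h2 := ψ.eval_mem M v w
  simp only [BFormula.min, BFormula.eval]
  rcases le_total (φ.eval M v w) (ψ.eval M v w) with h | h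
  · rw [min_eq_left h, max_eq_right (sub_nonpos.2 h), sub_zero, max_eq_left h1.1]
  · rw [min_eq_right h, max_eq_left (sub_nonneg.2 h), sub_sub_cancel, max_eq_left h2.1]

/-- The maximum of two formulae. -/
def BFormula.max {L : Signature.{u}} {α : Type*} {σ : α → L.Srt} {n : ℕ} {Γ : Fin n → L.Srt}
    (φ ψ : BFormula L σ n Γ) : BFormula L σ n Γ :=
  .neg (.min (.neg φ) (.neg ψ))

theorem BFormula.eval_max {L : Signature.{u}} {α : Type*} {σ : α → L.Srt} {n : ℕ}
    {Γ : Fin n → L.Srt} (φ ψ : BFormula L σ n Γ) (M : Struct L) (v : M.Tuple σ)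
    (w : M.Tuple Γ) : (φ.max ψ).eval M v w = Max.max (φ.eval M v w) (ψ.eval M v w) := by
  simp only [BFormula.max, BFormula.eval, BFormula.eval_min]
  rcases le_total (φ.eval M v w) (ψ.eval M v w) with h | h
  · rw [max_eq_right h, min_eq_right (by linarith)]; ring
  · rw [max_eq_left h, min_eq_left (by linarith)]; ring

/-! ### Uniform continuity -/

/-- Moduli are given one argument at a time, so `a` is changed into `b` one coordinate at a time;
each change costs at most `ε`. -/
theorem dist_le_of_coordinatewise {ι : Type*} [Fintype ι] {X : ι → Type*}
    [∀ j, PseudoMetricSpace (X j)] {Y : Type*} [PseudoMetricSpace Y] (F : (∀ j, X j) → Y)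
    {ε δ : ℝ} (h : ∀ i a b, (∀ j, j ≠ i → a j = b j) → dist (a i) (b i) < δ →
      dist (F a) (F b) ≤ ε) (a b : ∀ j, X j) (hab : ∀ j, dist (a j) (b j) < δ) :
    dist (F a) (F b) ≤ Fintype.card ι * ε := by
  classical
  have key : ∀ (s : Finset ι) (a : ∀ j, X j), (∀ j, dist (a j) (b j) < δ) →
      (∀ j, j ∉ s → a j = b j) → dist (F a) (F b) ≤ s.card * ε := by
    intro s
    induction s using Finset.induction_on with
    | empty =>
      intro a _ h2
      rw [funext fun j => h2 j (Finset.notMem_empty j)]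
      simp
    | insert i s hi ih =>
      intro a h1 h2
      have h3 : dist (F a) (F (Function.update a i (b i))) ≤ ε := by
        refine h i _ _ (fun j hj => by rw [Function.update_of_ne hj]) ?_
        rw [Function.update_self]
        exact h1 i
      have h4 : dist (F (Function.update a i (b i))) (F b) ≤ s.card * ε := by
        refine ih _ (fun j => ?_) (fun j hj => ?_)
        · by_cases hji : j = i
          · subst hji
            rw [Function.update_self, dist_self]
            exact dist_nonneg.trans_lt (h1 j)
          · rw [Function.update_of_ne hji]
            exact h1 j
        · by_cases hji : j = i
          · subst hji
            rw [Function.update_self]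
          · rw [Function.update_of_ne hji]
            exact h2 j (by simp [hji, hj])
      rw [Finset.card_insert_of_notMem hi]
      push_cast
      linarith [dist_triangle (F a) (F (Function.update a i (b i))) (F b)]
  exact key Finset.univ a hab (fun j hj => absurd (Finset.mem_univ j) hj)

/-- The bound `δ` does not depend on the structure, as ultraproducts require. Stating it for all
small `δ` lets finitely many such bounds be combined by intersecting filters. -/
theorem Struct.fn_uniform {L : Signature.{u}} (f : L.Fn) {ε : ℝ} (hε : 0 < ε) :
    ∀ᶠ δ in 𝓝[>] (0 : ℝ), ∀ (M : Struct L) (a b : ∀ i, M.Carrier (L.fnDom f i)),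
      (∀ i, dist (a i) (b i) < δ) → dist (M.fn f a) (M.fn f b) ≤ ε := by
  -- The error is divided by arity plus one, to allow for arity `0`.
  have hk : (0 : ℝ) < L.fnArity f + 1 := by positivity
  have h1 : ∀ i, ∀ᶠ δ in 𝓝[>] (0 : ℝ), δ ≤ (L.fnMod f i).toFun (ε / (L.fnArity f + 1)) :=
    fun i => Filter.eventually_of_mem
      (Ioc_mem_nhdsGT ((L.fnMod f i).pos _ (div_pos hε hk))) fun _ h => h.2
  filter_upwards [Filter.eventually_all.2 h1] with δ hδ M a b hab
  have := dist_le_of_coordinatewise (M.fn f) (fun i a b h3 h4 =>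
    M.fn_unif f i _ (div_pos hε hk) a b h3 (h4.trans_le (hδ i))) a b hab
  refine this.trans ?_
  rw [Fintype.card_fin, mul_div_assoc', div_le_iff₀ hk]
  nlinarith

theorem Struct.pr_uniform {L : Signature.{u}} (P : L.Pr) {ε : ℝ} (hε : 0 < ε) :
    ∀ᶠ δ in 𝓝[>] (0 : ℝ), ∀ (M : Struct L) (a b : ∀ i, M.Carrier (L.prDom P i)),
      (∀ i, dist (a i) (b i) < δ) → |M.pr P a - M.pr P b| ≤ ε := by
  have hk : (0 : ℝ) < L.prArity P + 1 := by positivity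
  have h1 : ∀ i, ∀ᶠ δ in 𝓝[>] (0 : ℝ), δ ≤ (L.prMod P i).toFun (ε / (L.prArity P + 1)) :=
    fun i => Filter.eventually_of_mem
      (Ioc_mem_nhdsGT ((L.prMod P i).pos _ (div_pos hε hk))) fun _ h => h.2
  filter_upwards [Filter.eventually_all.2 h1] with δ hδ M a b hab
  have := dist_le_of_coordinatewise (M.pr P) (fun i a b h3 h4 =>
    M.pr_unif P i _ (div_pos hε hk) a b h3 (h4.trans_le (hδ i))) a b hab
  refine this.trans ?_
  rw [Fintype.card_fin, mul_div_assoc', div_le_iff₀ hk]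
  nlinarith

theorem Term.eval_uniform {L : Signature.{u}} {α : Type*} {σ : α → L.Srt} {s : L.Srt}
    (t : Term L σ s) {ε : ℝ} (hε : 0 < ε) :
    ∀ᶠ δ in 𝓝[>] (0 : ℝ), ∀ (M : Struct L) (v v' : M.Tuple σ),
      (∀ a, dist (v a) (v' a) < δ) → dist (t.eval M v) (t.eval M v') ≤ ε := by
  induction t generalizing ε with
  | var a =>
    filter_upwards [Ioc_mem_nhdsGT hε] with δ hδ M v v' h
    exact (h a).le.trans hδ.2
  | app f ts ih =>
    obtain ⟨η, hη, hη0⟩ := ((Struct.fn_uniform f hε).and self_mem_nhdsWithin).exists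
    have hη0 : 0 < η := hη0
    filter_upwards [Filter.eventually_all.2 fun i => ih i (half_pos hη0)] with δ hδ M v v' h
    exact hη M _ _ fun i => (hδ i M v v' h).trans_lt (half_lt_self hη0)

theorem abs_iInf_sub_iInf_le {ι : Type*} [Nonempty ι] {f g : ι → ℝ}
    (hf : ∀ i, f i ∈ Set.Icc (0 : ℝ) 1) (hg : ∀ i, g i ∈ Set.Icc (0 : ℝ) 1) {ε : ℝ}
    (h : ∀ i, |f i - g i| ≤ ε) : |(⨅ i, f i) - ⨅ i, g i| ≤ ε := by
  have hf' : BddBelow (Set.range f) := ⟨0, by rintro _ ⟨i, rfl⟩; exact (hf i).1⟩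
  have hg' : BddBelow (Set.range g) := ⟨0, by rintro _ ⟨i, rfl⟩; exact (hg i).1⟩
  have h1 : (⨅ i, f i) - ε ≤ ⨅ i, g i := le_ciInf fun i => by
    linarith [ciInf_le hf' i, (abs_le.1 (h i)).2]
  have h2 : (⨅ i, g i) - ε ≤ ⨅ i, f i := le_ciInf fun i => by
    linarith [ciInf_le hg' i, (abs_le.1 (h i)).1]
  exact abs_le.2 ⟨by linarith, by linarith⟩

/-- This reduces the quantifier `sup` to `inf`, so that later inductions treat only one quantifier
in earnest. -/
theorem iSup_eq_one_sub_iInf {ι : Type*} [Nonempty ι] {f : ι → ℝ}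
    (hf : ∀ i, f i ∈ Set.Icc (0 : ℝ) 1) : ⨆ i, f i = 1 - ⨅ i, (1 - f i) := by
  have h1 : BddAbove (Set.range f) := ⟨1, by rintro _ ⟨i, rfl⟩; exact (hf i).2⟩
  have h2 : BddBelow (Set.range fun i => 1 - f i) :=
    ⟨0, by rintro _ ⟨i, rfl⟩; exact sub_nonneg.2 (hf i).2⟩
  refine le_antisymm (ciSup_le fun i => ?_) ?_
  · linarith [ciInf_le h2 i]
  · have : 1 - ⨆ i, f i ≤ ⨅ i, (1 - f i) := le_ciInf fun i => by linarith [le_ciSup h1 i]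
    linarith

theorem BFormula.eval_sup {L : Signature.{u}} {α : Type*} {σ : α → L.Srt} {n : ℕ}
    {Γ : Fin n → L.Srt} {s : L.Srt}
    (φ : BFormula L σ (n + 1) (Fin.cons s Γ : Fin (n + 1) → L.Srt)) (M : Struct L)
    (v : M.Tuple σ) (w : M.Tuple Γ) :
    (BFormula.sup s φ).eval M v w = (BFormula.neg (.inf s (.neg φ))).eval M v w := by
  simp only [BFormula.eval]
  exact iSup_eq_one_sub_iInf fun b => φ.eval_mem M v _

/-- Formulae are uniformly continuous, uniformly in all structures. -/
theorem BFormula.eval_uniform {L : Signature.{u}} {α : Type*} {σ : α → L.Srt} {n : ℕ}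
    {Γ : Fin n → L.Srt} (φ : BFormula L σ n Γ) {ε : ℝ} (hε : 0 < ε) :
    ∀ᶠ δ in 𝓝[>] (0 : ℝ), ∀ (M : Struct L) (v v' : M.Tuple σ) (w w' : M.Tuple Γ),
      (∀ a, Dist.dist (v a) (v' a) < δ) → (∀ i, Dist.dist (w i) (w' i) < δ) →
        |φ.eval M v w - φ.eval M v' w'| ≤ ε := by
  have hj : ∀ (M : Struct L) {n : ℕ} {Γ : Fin n → L.Srt} (v v' : M.Tuple σ) (w w' : M.Tuple Γ)
      (δ : ℝ), (∀ a, Dist.dist (v a) (v' a) < δ) → (∀ i, Dist.dist (w i) (w' i) < δ) →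
        ∀ x, Dist.dist (M.join v w x) (M.join v' w' x) < δ := by
    rintro M n Γ v v' w w' δ h1 h2 (a | i)
    exacts [h1 a, h2 i]
  have hc : ∀ (M : Struct L) {n : ℕ} {Γ : Fin n → L.Srt} {s : L.Srt} (b : M.Carrier s)
      (w w' : M.Tuple Γ) (δ : ℝ), 0 < δ → (∀ i, Dist.dist (w i) (w' i) < δ) →
        ∀ i, Dist.dist (M.cons b w i) (M.cons b w' i) < δ := by
    intro M n Γ s b w w' δ h0 h i
    induction i using Fin.cases with
    | zero => exact (dist_self b).trans_lt h0
    | succ i => exact h i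
  induction φ generalizing ε with
  | dist s t₁ t₂ =>
    filter_upwards [t₁.eval_uniform (half_pos hε), t₂.eval_uniform (half_pos hε)]
      with δ h1 h2 M v v' w w' hv hw
    have h3 := h1 M _ _ (hj M v v' w w' δ hv hw)
    have h4 := h2 M _ _ (hj M v v' w w' δ hv hw)
    have := dist_dist_dist_le (t₁.eval M (M.join v w)) (t₂.eval M (M.join v w))
      (t₁.eval M (M.join v' w')) (t₂.eval M (M.join v' w'))
    rw [Real.dist_eq] at this
    simp only [BFormula.eval]
    linarith
  | pred P ts =>
    obtain ⟨η, hη, hη0⟩ := ((Struct.pr_uniform P hε).and self_mem_nhdsWithin).exists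
    have hη0 : 0 < η := hη0
    filter_upwards [Filter.eventually_all.2 fun i => (ts i).eval_uniform (half_pos hη0)]
      with δ hδ M v v' w w' hv hw
    exact hη M _ _ fun i =>
      (hδ i M _ _ (hj M v v' w w' δ hv hw)).trans_lt (half_lt_self hη0)
  | neg φ ih =>
    filter_upwards [ih hε] with δ h M v v' w w' hv hw
    simp only [BFormula.eval]
    have := h M v v' w w' hv hw
    rw [abs_sub_comm] at this
    convert this using 2
    ring
  | half φ ih =>
    filter_upwards [ih hε] with δ h M v v' w w' hv hw
    simp only [BFormula.eval]
    have := abs_le.1 (h M v v' w w' hv hw)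
    exact abs_le.2 ⟨by linarith [this.1], by linarith [this.2]⟩
  | dotminus φ ψ ih₁ ih₂ =>
    filter_upwards [ih₁ (half_pos hε), ih₂ (half_pos hε)] with δ h1 h2 M v v' w w' hv hw
    simp only [BFormula.eval]
    have h3 := abs_le.1 (h1 M v v' w w' hv hw)
    have h4 := abs_le.1 (h2 M v v' w w' hv hw)
    refine (abs_max_sub_max_le_abs _ _ _).trans (abs_le.2 ⟨?_, ?_⟩)
    · linarith [h3.1, h4.2]
    · linarith [h3.2, h4.1]
  | inf s φ ih =>
    filter_upwards [ih hε, self_mem_nhdsWithin] with δ h h0 M v v' w w' hv hw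
    exact abs_iInf_sub_iInf_le (fun b => φ.eval_mem M _ _) (fun b => φ.eval_mem M _ _)
      fun b => h M v v' _ _ hv (hc M b w w' δ h0 hw)
  | sup s φ ih =>
    filter_upwards [ih hε, self_mem_nhdsWithin] with δ h h0 M v v' w w' hv hw
    rw [BFormula.eval_sup, BFormula.eval_sup]
    simp only [BFormula.eval, sub_sub_sub_cancel_left]
    refine abs_iInf_sub_iInf_le (fun b => (BFormula.neg φ).eval_mem M v' (M.cons b w'))
      (fun b => (BFormula.neg φ).eval_mem M v (M.cons b w)) fun b => ?_
    rw [BFormula.eval, BFormula.eval, sub_sub_sub_cancel_left]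
    exact h M v v' _ _ hv (hc M b w w' δ h0 hw)

/-! ### Metric ultraproducts -/

/-- The limit of a family of reals along an ultrafilter. -/
noncomputable def ulim {I : Type*} (U : Ultrafilter I) (f : I → ℝ) : ℝ :=
  ((U : Filter I).map f).lim

theorem tendsto_ulim {I : Type*} (U : Ultrafilter I) {f : I → ℝ}
    (hf : ∀ i, f i ∈ Set.Icc (0 : ℝ) 1) : Filter.Tendsto f U (𝓝 (ulim U f)) := by
  have h := (isCompact_Icc (a := (0 : ℝ)) (b := 1)).ultrafilter_le_nhds (U.map f) (by
    rw [Filter.le_principal_iff]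
    exact Filter.Eventually.of_forall (f := (U : Filter I)) hf)
  obtain ⟨x, _, hx⟩ := h
  exact le_nhds_lim ⟨x, hx⟩

/-- Choice functions from a family of metric spaces, with the distance given by the limit along
an ultrafilter. -/
def UPre {I : Type u} (_U : Ultrafilter I) (X : I → Type u) : Type u := ∀ i, X i

theorem Struct.dist_mem {L : Signature.{u}} (M : Struct L) {s : L.Srt} (x y : M.Carrier s) :
    dist x y ∈ Set.Icc (0 : ℝ) 1 := ⟨dist_nonneg, M.dist_le_one s x y⟩

noncomputable instance UPre.pseudoMetricSpace {L : Signature.{u}} {I : Type u}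
    (U : Ultrafilter I) (M : I → Struct L) (s : L.Srt) :
    PseudoMetricSpace (UPre U fun i => (M i).Carrier s) where
  dist x y := ulim U fun i => dist (x i) (y i)
  dist_self x := by
    have := tendsto_ulim U (f := fun i => dist (x i) (x i)) fun i => (M i).dist_mem _ _
    refine tendsto_nhds_unique this ?_
    simp
  dist_comm x y := by simp only [dist_comm]
  dist_triangle x y z := by
    have h1 := tendsto_ulim U (f := fun i => dist (x i) (y i)) fun i => (M i).dist_mem _ _
    have h2 := tendsto_ulim U (f := fun i => dist (y i) (z i)) fun i => (M i).dist_mem _ _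
    have h3 := tendsto_ulim U (f := fun i => dist (x i) (z i)) fun i => (M i).dist_mem _ _
    exact le_of_tendsto_of_tendsto' h3 (h1.add h2) fun i => dist_triangle _ _ _

theorem UPre.tendsto_dist {L : Signature.{u}} {I : Type u} {U : Ultrafilter I}
    {M : I → Struct L} {s : L.Srt} (x y : UPre U fun i => (M i).Carrier s) :
    Filter.Tendsto (fun i => dist (x i) (y i)) U (𝓝 (dist x y)) :=
  tendsto_ulim U fun i => (M i).dist_mem _ _

/-- Freeze the sequence at the first index where control fails. The frozen sequence converges, and
it agrees with `x` as long as control has held. The point `y` is thus chosen before it is known how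
long control lasts. -/
theorem exists_limit_of_controlled {X : Type*} [MetricSpace X] [CompleteSpace X] (x : ℕ → X) :
    ∃ y, ∀ n, (∀ k < n, dist (x k) (x (k + 1)) ≤ 1 / 2 / 2 ^ k) → dist (x n) y ≤ 1 / 2 ^ n := by
  obtain ⟨z, hz, hx⟩ : ∃ z : ℕ → X, (∀ k, dist (z k) (z (k + 1)) ≤ 1 / 2 / 2 ^ k) ∧
      ∀ n, (∀ k < n, dist (x k) (x (k + 1)) ≤ 1 / 2 / 2 ^ k) → z n = x n := by
    by_cases h : ∀ k, dist (x k) (x (k + 1)) ≤ 1 / 2 / 2 ^ k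
    · exact ⟨x, h, fun _ _ => rfl⟩
    · push Not at h
      classical
      refine ⟨fun k => x (min k (Nat.find h)), fun k => ?_, fun n hn => ?_⟩
      · rcases lt_or_ge k (Nat.find h) with hk | hk
        · simp only [min_eq_left hk.le, min_eq_left (Nat.succ_le_of_lt hk)]
          exact not_lt.1 (Nat.find_min h hk)
        · simp only [min_eq_right hk, min_eq_right (hk.trans (Nat.le_succ k)), dist_self]
          positivity
      · have : n ≤ Nat.find h := by
          by_contra hlt
          exact (Nat.find_spec h).not_ge (hn _ (not_le.1 hlt))
        simp only [min_eq_left this]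
  obtain ⟨y, hy⟩ := cauchySeq_tendsto_of_complete (cauchySeq_of_le_geometric_two hz)
  exact ⟨y, fun n hn => hx n hn ▸ dist_le_of_le_geometric_two_of_tendsto hz hy n⟩

/-- No completion is needed: limits are taken coordinatewise. For each `n`, the first `n` steps are
controlled in almost all coordinates, which bounds the limit distance by `2⁻ⁿ`. -/
instance UPre.completeSpace {L : Signature.{u}} {I : Type u}
    (U : Ultrafilter I) (M : I → Struct L) (s : L.Srt) :
    CompleteSpace (UPre U fun i => (M i).Carrier s) := by
  refine Metric.complete_of_convergent_controlled_sequences (fun n => 1 / 2 / 2 ^ n)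
    (fun n => by positivity) fun x hx => ?_
  choose y hy using fun i => exists_limit_of_controlled fun n => x n i
  obtain ⟨y, rfl⟩ : ∃ y' : UPre U fun i => (M i).Carrier s, y' = y := ⟨y, rfl⟩
  refine ⟨y, ?_⟩
  rw [tendsto_iff_dist_tendsto_zero]
  refine squeeze_zero (g := fun n : ℕ => 1 / 2 ^ n) (fun n => dist_nonneg) (fun n => ?_) ?_
  · refine le_of_tendsto (UPre.tendsto_dist (x n) y) ?_
    have : ∀ k, ∀ᶠ i in (U : Filter I), dist (x k i) (x (k + 1) i) ≤ 1 / 2 / 2 ^ k := fun k =>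
      ((UPre.tendsto_dist (x k) (x (k + 1))).eventually_lt_const
        (hx k k (k + 1) le_rfl (Nat.le_succ k))).mono fun i hi => hi.le
    have h2 : ∀ᶠ i in (U : Filter I), ∀ k ∈ Finset.range n,
        dist (x k i) (x (k + 1) i) ≤ 1 / 2 / 2 ^ k := (Finset.eventually_all _).2 fun k _ => this k
    filter_upwards [h2] with i hi
    exact hy i n fun k hk => hi k (Finset.mem_range.2 hk)
  · simpa using tendsto_pow_atTop_nhds_zero_of_lt_one (r := (1 / 2 : ℝ)) (by norm_num)
      (by norm_num)

/-- The sorts of the ultraproduct. -/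
abbrev UCarrier {L : Signature.{u}} {I : Type u} (U : Ultrafilter I) (M : I → Struct L)
    (s : L.Srt) : Type u :=
  SeparationQuotient (UPre U fun i => (M i).Carrier s)

/-- The class of a choice function in the ultraproduct. -/
noncomputable def umk {L : Signature.{u}} {I : Type u} (U : Ultrafilter I) {M : I → Struct L} {s : L.Srt}
    (x : ∀ i, (M i).Carrier s) : UCarrier U M s :=
  SeparationQuotient.mk (X := UPre U fun i => (M i).Carrier s) x

/-- A representative of an element of the ultraproduct. -/
noncomputable def urep {L : Signature.{u}} {I : Type u} {U : Ultrafilter I} {M : I → Struct L}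
    {s : L.Srt} (x : UCarrier U M s) : ∀ i, (M i).Carrier s :=
  Quotient.out x

theorem umk_urep {L : Signature.{u}} {I : Type u} {U : Ultrafilter I} {M : I → Struct L}
    {s : L.Srt} (x : UCarrier U M s) : umk U (urep x) = x := Quotient.out_eq x

theorem tendsto_dist_umk {L : Signature.{u}} {I : Type u} {U : Ultrafilter I}
    {M : I → Struct L} {s : L.Srt} (x y : ∀ i, (M i).Carrier s) :
    Filter.Tendsto (fun i => dist (x i) (y i)) U
      (𝓝 (dist (umk U x : UCarrier U M s) (umk U y))) := by
  have h := SeparationQuotient.dist_mk (α := UPre U fun i => (M i).Carrier s) x y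
  exact Eq.subst (motive := fun r => Filter.Tendsto (fun i => dist (x i) (y i)) U (𝓝 r)) h.symm
    (UPre.tendsto_dist (M := M) x y)

theorem tendsto_dist_urep {L : Signature.{u}} {I : Type u} {U : Ultrafilter I}
    {M : I → Struct L} {s : L.Srt} (x y : UCarrier U M s) :
    Filter.Tendsto (fun i => dist (urep x i) (urep y i)) U (𝓝 (dist x y)) := by
  conv in 𝓝 _ => rw [← umk_urep x, ← umk_urep y]
  exact tendsto_dist_umk _ _

/-- The metric ultraproduct of a family of structures. -/
noncomputable def ultra {L : Signature.{u}} {I : Type u} (U : Ultrafilter I)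
    (M : I → Struct L) : Struct L where
  Carrier s := UCarrier U M s
  nonempty s := ⟨umk U fun i => Classical.arbitrary _⟩
  dist_le_one s x y :=
    le_of_tendsto' (tendsto_dist_urep x y) fun i => (M i).dist_le_one s _ _
  fn f a := umk U fun i => (M i).fn f fun j => urep (a j) i
  pr P a := ulim U fun i => (M i).pr P fun j => urep (a j) i
  pr_mem P a := isClosed_Icc.mem_of_tendsto
    (tendsto_ulim U fun i => (M i).pr_mem P fun j => urep (a j) i)
    (Filter.Eventually.of_forall fun i => (M i).pr_mem P _)
  fn_unif f j ε hε a b h hd := by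
    refine le_of_tendsto (tendsto_dist_umk _ _) ?_
    filter_upwards [(tendsto_dist_urep (a j) (b j)).eventually_lt_const hd] with i hi
    exact (M i).fn_unif f j ε hε _ _ (fun k hk => by rw [h k hk]) hi
  pr_unif P j ε hε a b h hd := by
    refine le_of_tendsto (((tendsto_ulim U fun i => (M i).pr_mem P fun j => urep (a j) i).sub
      (tendsto_ulim U fun i => (M i).pr_mem P fun j => urep (b j) i)).abs) ?_
    filter_upwards [(tendsto_dist_urep (a j) (b j)).eventually_lt_const hd] with i hi
    exact (M i).pr_unif P j ε hε _ _ (fun k hk => by rw [h k hk]) hi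
  dist_unif_left s ε hε x y z hd := by
    refine le_of_tendsto (((tendsto_dist_urep x z).sub (tendsto_dist_urep y z)).abs) ?_
    filter_upwards [(tendsto_dist_urep x y).eventually_lt_const hd] with i hi
    exact (M i).dist_unif_left s ε hε _ _ _ hi
  dist_unif_right s ε hε x y z hd := by
    refine le_of_tendsto (((tendsto_dist_urep z x).sub (tendsto_dist_urep z y)).abs) ?_
    filter_upwards [(tendsto_dist_urep x y).eventually_lt_const hd] with i hi
    exact (M i).dist_unif_right s ε hε _ _ _ hi

/-- The tuple in the ultraproduct given by a family of tuples. -/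
noncomputable def utup {L : Signature.{u}} {I : Type u} (U : Ultrafilter I) {M : I → Struct L} {α : Type*}
    {σ : α → L.Srt} (v : ∀ i, (M i).Tuple σ) : (ultra U M).Tuple σ :=
  fun a => umk U fun i => v i a

theorem join_utup {L : Signature.{u}} {I : Type u} (U : Ultrafilter I) {M : I → Struct L}
    {α β : Type*} {σ : α → L.Srt} {τ : β → L.Srt} (v : ∀ i, (M i).Tuple σ)
    (w : ∀ i, (M i).Tuple τ) :
    (ultra U M).join (utup U v) (utup U w) = utup U fun i => (M i).join (v i) (w i) := by
  funext x
  rcases x with a | b <;> rfl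

theorem cons_utup {L : Signature.{u}} {I : Type u} (U : Ultrafilter I) {M : I → Struct L}
    {n : ℕ} {Γ : Fin n → L.Srt} {s : L.Srt} (b : ∀ i, (M i).Carrier s)
    (w : ∀ i, (M i).Tuple Γ) :
    (ultra U M).cons (umk U b) (utup U w) = utup U fun i => (M i).cons (b i) (w i) := by
  funext x
  induction x using Fin.cases <;> rfl

theorem tendsto_dist_urep_umk {L : Signature.{u}} {I : Type u} {U : Ultrafilter I}
    {M : I → Struct L} {s : L.Srt} (x : ∀ i, (M i).Carrier s) :
    Filter.Tendsto (fun i => dist (urep (umk U x : UCarrier U M s) i) (x i)) U (𝓝 0) := by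
  have := tendsto_dist_umk (U := U) (M := M) (urep (umk U x : UCarrier U M s)) x
  rwa [umk_urep, dist_self] at this

/-- The functions of `ultra` are defined through chosen representatives. Uniform continuity makes
the result independent of that choice. -/
theorem fn_utup {L : Signature.{u}} {I : Type u} (U : Ultrafilter I) {M : I → Struct L}
    (f : L.Fn) (v : ∀ i, (M i).Tuple (L.fnDom f)) :
    (ultra U M).fn f (utup U v) = umk U fun i => (M i).fn f (v i) := by
  refine eq_of_dist_eq_zero (tendsto_nhds_unique (tendsto_dist_umk (U := U) (M := M)
    (fun i => (M i).fn f fun j => urep (utup U v j) i) (fun i => (M i).fn f (v i))) ?_)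
  refine (nhds_basis_Ioo_pos (0 : ℝ)).tendsto_right_iff.2 fun ε hε => ?_
  obtain ⟨δ, hδ, h0⟩ :=
    ((Struct.fn_uniform f (half_pos hε)).and self_mem_nhdsWithin).exists
  filter_upwards [Filter.eventually_all.2 fun j =>
    (tendsto_dist_urep_umk (U := U) (M := M) fun i => v i j).eventually_lt_const h0] with i hi
  have h2 : dist ((M i).fn f fun j => urep (utup U v j) i) ((M i).fn f (v i)) ≤ ε / 2 :=
    hδ (M i) _ _ hi
  exact ⟨(sub_lt_self 0 hε).trans_le dist_nonneg, by linarith⟩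

theorem tendsto_pr_utup {L : Signature.{u}} {I : Type u} (U : Ultrafilter I)
    {M : I → Struct L} (P : L.Pr) (v : ∀ i, (M i).Tuple (L.prDom P)) :
    Filter.Tendsto (fun i => (M i).pr P (v i)) U (𝓝 ((ultra U M).pr P (utup U v))) := by
  have h1 : Filter.Tendsto (fun i => (M i).pr P (v i) -
      (M i).pr P fun j => urep (utup U v j) i) U (𝓝 0) := by
    refine (nhds_basis_Ioo_pos (0 : ℝ)).tendsto_right_iff.2 fun ε hε => ?_
    obtain ⟨δ, hδ, h0⟩ :=
      ((Struct.pr_uniform P (half_pos hε)).and self_mem_nhdsWithin).exists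
    filter_upwards [Filter.eventually_all.2 fun j =>
      (tendsto_dist_urep_umk (U := U) (M := M) fun i => v i j).eventually_lt_const h0] with i hi
    have : |((M i).pr P fun j => urep (utup U v j) i) - (M i).pr P (v i)| ≤ ε / 2 :=
      hδ (M i) _ _ hi
    have := abs_le.1 this
    exact ⟨by linarith [this.2], by linarith [this.1]⟩
  have h2 := h1.add (tendsto_ulim U fun i => (M i).pr_mem P fun j => urep (utup U v j) i)
  simp only [sub_add_cancel, zero_add] at h2
  exact h2

theorem eval_utup {L : Signature.{u}} {I : Type u} (U : Ultrafilter I) {M : I → Struct L}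
    {α : Type*} {σ : α → L.Srt} (v : ∀ i, (M i).Tuple σ) {s : L.Srt} (t : Term L σ s) :
    t.eval (ultra U M) (utup U v) = umk U fun i => t.eval (M i) (v i) := by
  induction t with
  | var a => rfl
  | app f ts ih =>
    simp only [Term.eval, ih]
    exact fn_utup U f fun i j => (ts j).eval (M i) (v i)

/-- Near-minimisers chosen in every coordinate define an element of the ultraproduct, which bounds
the limit from below. A representative of a near-minimiser in the ultraproduct bounds it from above.
-/
theorem tendsto_iInf {L : Signature.{u}} {I : Type u} (U : Ultrafilter I) {M : I → Struct L}
    {s : L.Srt} {F : ∀ i, (M i).Carrier s → ℝ} {G : (ultra U M).Carrier s → ℝ}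
    (hF : ∀ i b, F i b ∈ Set.Icc (0 : ℝ) 1) (hG : ∀ b, G b ∈ Set.Icc (0 : ℝ) 1)
    (h : ∀ b : ∀ i, (M i).Carrier s,
      Filter.Tendsto (fun i => F i (b i)) U (𝓝 (G (umk U b)))) :
    Filter.Tendsto (fun i => ⨅ b, F i b) U (𝓝 (⨅ b, G b)) := by
  have bF : ∀ i, BddBelow (Set.range (F i)) := fun i =>
    ⟨0, by rintro _ ⟨b, rfl⟩; exact (hF i b).1⟩
  have bG : BddBelow (Set.range G) := ⟨0, by rintro _ ⟨b, rfl⟩; exact (hG b).1⟩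
  refine (nhds_basis_Ioo_pos _).tendsto_right_iff.2 fun ε hε => ?_
  choose b hb using fun i => exists_lt_of_ciInf_lt (lt_add_of_pos_right (⨅ b, F i b)
    (half_pos hε))
  obtain ⟨c, hc⟩ := exists_lt_of_ciInf_lt (lt_add_of_pos_right (⨅ b, G b) hε)
  obtain ⟨c, rfl⟩ : ∃ c', umk U c' = c := ⟨urep c, umk_urep c⟩
  have h1 := (h b).eventually_const_lt (show (⨅ b, G b) - ε / 2 < G (umk U b) by
    linarith [ciInf_le bG (umk U b)])
  filter_upwards [h1, (h c).eventually_lt_const hc] with i h2 h3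
  exact ⟨by linarith [hb i], by linarith [ciInf_le (bF i) (c i)]⟩

/-- Łoś's theorem: the value of a formula in an ultraproduct is the limit of its values. -/
theorem tendsto_eval_ultra {L : Signature.{u}} {I : Type u} (U : Ultrafilter I)
    {M : I → Struct L} {α : Type*} {σ : α → L.Srt} {n : ℕ} {Γ : Fin n → L.Srt}
    (φ : BFormula L σ n Γ) (v : ∀ i, (M i).Tuple σ) (w : ∀ i, (M i).Tuple Γ) :
    Filter.Tendsto (fun i => φ.eval (M i) (v i) (w i)) U
      (𝓝 (φ.eval (ultra U M) (utup U v) (utup U w))) := by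
  have hinf : ∀ {n : ℕ} {Γ : Fin n → L.Srt} (s : L.Srt)
      (φ : BFormula L σ (n + 1) (Fin.cons s Γ : Fin (n + 1) → L.Srt)),
      (∀ w : ∀ i, (M i).Tuple (Fin.cons s Γ : Fin (n + 1) → L.Srt),
        Filter.Tendsto (fun i => φ.eval (M i) (v i) (w i)) U
          (𝓝 (φ.eval (ultra U M) (utup U v) (utup U w)))) →
      ∀ w : ∀ i, (M i).Tuple Γ,
        Filter.Tendsto (fun i => (BFormula.inf s φ).eval (M i) (v i) (w i)) U
          (𝓝 ((BFormula.inf s φ).eval (ultra U M) (utup U v) (utup U w))) := by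
    intro n Γ s φ ih w
    refine tendsto_iInf U (F := fun i b => φ.eval (M i) (v i) ((M i).cons b (w i)))
      (G := fun b => φ.eval (ultra U M) (utup U v) ((ultra U M).cons b (utup U w)))
      (fun i b => φ.eval_mem _ _ _) (fun b => φ.eval_mem _ _ _) fun b => ?_
    simp only [cons_utup]
    exact ih _
  induction φ with
  | dist s t₁ t₂ =>
    simp only [BFormula.eval, join_utup, eval_utup]
    exact tendsto_dist_umk _ _
  | pred P ts =>
    simp only [BFormula.eval, join_utup, eval_utup]
    exact tendsto_pr_utup U P fun i j => (ts j).eval (M i) ((M i).join (v i) (w i))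
  | neg φ ih => exact (ih w).const_sub 1
  | half φ ih => exact (ih w).div_const 2
  | dotminus φ ψ ih₁ ih₂ => exact ((ih₁ w).sub (ih₂ w)).max tendsto_const_nhds
  | inf s φ ih => exact hinf s φ ih w
  | sup s φ ih =>
    simp only [BFormula.eval_sup]
    exact (hinf s (.neg φ) (fun w => (ih w).const_sub 1) w).const_sub 1

theorem tendsto_val_ultra {L : Signature.{u}} {I : Type u} (U : Ultrafilter I)
    {M : I → Struct L} {α : Type*} {σ : α → L.Srt} (φ : Formula L σ)
    (v : ∀ i, (M i).Tuple σ) :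
    Filter.Tendsto (fun i => φ.val (M i) (v i)) U (𝓝 (φ.val (ultra U M) (utup U v))) := by
  have h := tendsto_eval_ultra U φ v fun i j => j.elim0
  have h2 : (utup U fun i j => j.elim0 : (ultra U M).Tuple fun j : Fin 0 => (j.elim0 : L.Srt)) =
      fun j => j.elim0 := funext fun j => j.elim0
  rwa [h2] at h

theorem ultra_models {L : Signature.{u}} {I : Type u} (U : Ultrafilter I) {M : I → Struct L}
    {T : Theory L} (h : ∀ i, (M i).Models T) : (ultra U M).Models T := by
  intro φ hφ
  have h1 := tendsto_val_ultra U (M := M) φ fun i j => j.elim0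
  have h2 : (utup U fun i j => j.elim0 : (ultra U M).Tuple fun j : Fin 0 => (j.elim0 : L.Srt)) =
      fun j => j.elim0 := funext fun j => j.elim0
  simp only [h _ φ hφ, h2] at h1
  exact tendsto_nhds_unique h1 tendsto_const_nhds

/-! ### Types over sets of parameters -/

/-- The sorts of the elements of `A`, regarded as variables. -/
abbrev Struct.Subset.sort {L : Signature.{u}} {M : Struct L} (A : M.Subset) :
    (Σ s, A s) → L.Srt := fun x => x.1

/-- The interpretation of the elements of `A` in a model of `T(A)`. -/
def ModelOver.params {L : Signature.{u}} {M : Struct L} {A : M.Subset} (N : ModelOver A) :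
    N.N.Tuple A.sort := fun x => N.c x.1 x.2

/-- It is convenient to treat all elements of `A` as free variables; finite support returns to the
finite tuples of parameters allowed in `FormulaOver`. -/
theorem exists_formulaOver {L : Signature.{u}} {M : Struct L} {A : M.Subset} {n : ℕ}
    {Γ : Fin n → L.Srt} (ψ : BFormula L A.sort n Γ) :
    ∃ χ : FormulaOver A Γ, ∀ (N : ModelOver A) (a : N.N.Tuple Γ),
      χ.val N a = ψ.eval N.N N.params a := by
  obtain ⟨m, e, φ, h⟩ := ψ.exists_fin
  exact ⟨⟨m, fun j => (e j).1, φ.free, fun j => (e j).2⟩, fun N a =>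
    (φ.val_free N.N (fun j => N.c (e j).1 (e j).2) a).trans (h N.N N.params a)⟩

/-- A formula over `A`, with all elements of `A` as free variables. -/
def FormulaOver.toBFormula {L : Signature.{u}} {M : Struct L} {A : M.Subset} {n : ℕ}
    {Γ : Fin n → L.Srt} (ψ : FormulaOver A Γ) : BFormula L A.sort n Γ :=
  ψ.φ.bind.rename fun j => .var (σ := A.sort) ⟨ψ.Δ j, ψ.b j⟩

theorem FormulaOver.eval_toBFormula {L : Signature.{u}} {M : Struct L} {A : M.Subset} {n : ℕ}
    {Γ : Fin n → L.Srt} (ψ : FormulaOver A Γ) (N : ModelOver A) (a : N.N.Tuple Γ) :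
    ψ.toBFormula.eval N.N N.params a = ψ.val N a :=
  (BFormula.eval_rename _ _ _ _ _).trans (Formula.eval_bind _ _ _ _)

theorem ModelOver.val_params {L : Signature.{u}} {M : Struct L} {A : M.Subset}
    (N : ModelOver A) (χ : Formula L A.sort) :
    χ.val N.N N.params = χ.val M fun x => (x.2 : M.Carrier x.1) := by
  obtain ⟨m, e, φ, h⟩ := χ.exists_fin
  rw [Formula.val, Formula.val, ← h, ← h]
  exact N.val_eq m (fun j => (e j).1) φ (fun j => (e j).2)

/-- The type of a tuple in a model of `T(A)`. -/
noncomputable def ModelOver.typeOf {L : Signature.{u}} {M : Struct L} {A : M.Subset} {n : ℕ}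
    {Γ : Fin n → L.Srt} (N : ModelOver A) (a : N.N.Tuple Γ) : TypeSpace A Γ :=
  ⟨fun ψ => ψ.val N a, N, a, fun _ => rfl⟩

/-- Every type over `A` is a limit of types of tuples in a given model of `T(A)`. -/
theorem exists_ultrafilter_tendsto {L : Signature.{u}} {M : Struct L} {A : M.Subset} {n : ℕ}
    {Γ : Fin n → L.Srt} (N₁ N₂ : ModelOver A) (a : N₁.N.Tuple Γ) :
    ∃ U : Ultrafilter (N₂.N.Tuple Γ), ∀ ψ : BFormula L A.sort n Γ,
      Filter.Tendsto (fun x => ψ.eval N₂.N N₂.params x) U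
        (𝓝 (ψ.eval N₁.N N₁.params a)) := by
  let J := {ψ : BFormula L A.sort n Γ // ψ.eval N₁.N N₁.params a ≤ 0} × {ε : ℝ // 0 < ε}
  let S : J → Set (N₂.N.Tuple Γ) := fun j => {x | j.1.1.eval N₂.N N₂.params x < j.2.1}
  have hne : ∀ j, (S j).Nonempty := by
    rintro ⟨⟨ψ, hψ⟩, ⟨ε, hε⟩⟩
    -- The infimum of `ψ` is a sentence over `A`, so its value, at most `0` because of `a`, is the
    -- same in `N₂`.
    obtain ⟨χ, hχ⟩ := exists_infAll ψ
    refine (hχ N₂.N N₂.params).2 ε ?_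
    rw [N₂.val_params, ← N₁.val_params]
    exact (((hχ N₁.N N₁.params).1 a).trans hψ).trans_lt hε
  have hdir : Directed (· ≥ ·) fun j => Filter.principal (S j) := by
    rintro ⟨⟨ψ₁, h₁⟩, ⟨ε₁, hε₁⟩⟩ ⟨⟨ψ₂, h₂⟩, ⟨ε₂, hε₂⟩⟩
    refine ⟨⟨⟨ψ₁.max ψ₂, by rw [BFormula.eval_max]; exact max_le h₁ h₂⟩,
      ⟨min ε₁ ε₂, lt_min hε₁ hε₂⟩⟩, ?_, ?_⟩
    · refine Filter.principal_mono.2 fun x hx => ?_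
      simp only [S, Set.mem_ofPred_eq, BFormula.eval_max] at hx ⊢
      exact (le_max_left _ _).trans_lt (hx.trans_le (min_le_left _ _))
    · refine Filter.principal_mono.2 fun x hx => ?_
      simp only [S, Set.mem_ofPred_eq, BFormula.eval_max] at hx ⊢
      exact (le_max_right _ _).trans_lt (hx.trans_le (min_le_right _ _))
  have hbot : (⨅ j, Filter.principal (S j)).NeBot :=
    Filter.iInf_neBot_of_directed hdir fun j => Filter.principal_neBot_iff.2 (hne j)
  refine ⟨Ultrafilter.of (⨅ j, Filter.principal (S j)), fun ψ => ?_⟩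
  have key : ∀ χ : BFormula L A.sort n Γ, χ.eval N₁.N N₁.params a ≤ 0 → ∀ ε > 0,
      ∀ᶠ x in (Ultrafilter.of (⨅ j, Filter.principal (S j)) : Filter _),
        χ.eval N₂.N N₂.params x < ε := fun χ hχ ε hε =>
    Ultrafilter.of_le _ (Filter.mem_iInf_of_mem (⟨⟨χ, hχ⟩, ⟨ε, hε⟩⟩ : J)
      (Filter.mem_principal_self _))
  refine (nhds_basis_Ioo_pos _).tendsto_right_iff.2 fun ε hε => ?_
  have hr := ψ.eval_mem N₁.N N₁.params a
  have hr' := (BFormula.neg ψ).eval_mem N₁.N N₁.params a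
  have e3 : 0 < ε / 3 := by positivity
  obtain ⟨χ₁, q₁, h1, h2, hχ₁⟩ := ψ.exists_const hr e3
  obtain ⟨χ₂, q₂, h3, h4, hχ₂⟩ := ψ.exists_const hr' e3
  -- Upper and lower bounds on `ψ` become formulae vanishing at `a`, namely `q₁ ∸ ψ` and `q₂ ∸ ¬ψ`.
  -- Each rounding and each vanishing condition costs `ε / 3`.
  filter_upwards [key (.dotminus χ₁ ψ) (by simp [BFormula.eval, hχ₁, h1]) _ e3,
    key (.dotminus χ₂ (.neg ψ)) (by simpa [BFormula.eval, hχ₂] using h3) _ e3] with x hx1 hx2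
  simp only [BFormula.eval, hχ₁, hχ₂, max_lt_iff] at hx1 hx2 h4
  exact ⟨by linarith [hx1.1], by linarith [hx2.1]⟩

/-! ### Realising types in ultrapowers, and the distance of types -/

/-- An ultrapower of a model of `T(A)`, as a model of `T(A)`. -/
noncomputable def ModelOver.upow {L : Signature.{u}} {M : Struct L} {A : M.Subset} {I : Type u}
    (U : Ultrafilter I) (N : ModelOver A) : ModelOver A where
  N := ultra U fun _ => N.N
  c s x := umk U fun _ => N.c s x
  val_eq m Δ φ b := by
    rw [← N.val_eq]
    exact tendsto_nhds_unique
      (tendsto_val_ultra U (M := fun _ => N.N) φ fun _ j => N.c (Δ j) (b j)) tendsto_const_nhds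

theorem ModelOver.tendsto_eval_upow {L : Signature.{u}} {M : Struct L} {A : M.Subset}
    {I : Type u} (U : Ultrafilter I) (N : ModelOver A) {n : ℕ} {Γ : Fin n → L.Srt}
    (ψ : BFormula L A.sort n Γ) (w : I → N.N.Tuple Γ) :
    Filter.Tendsto (fun i => ψ.eval N.N N.params (w i)) U
      (𝓝 (ψ.eval (N.upow U).N (N.upow U).params (utup U w))) :=
  tendsto_eval_ultra U (M := fun _ => N.N) ψ (fun _ => N.params) w

theorem ModelOver.tendsto_val_upow {L : Signature.{u}} {M : Struct L} {A : M.Subset}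
    {I : Type u} (U : Ultrafilter I) (N : ModelOver A) {n : ℕ} {Γ : Fin n → L.Srt}
    (ψ : FormulaOver A Γ) (w : I → N.N.Tuple Γ) :
    Filter.Tendsto (fun i => ψ.val N (w i)) U (𝓝 (ψ.val (N.upow U) (utup U w))) := by
  refine Filter.Tendsto.congr (fun i => ψ.eval_toBFormula N (w i)) ?_
  exact (N.tendsto_eval_upow U ψ.toBFormula w).trans
    (congrArg 𝓝 (ψ.eval_toBFormula (N.upow U) (utup U w))).le

theorem TypeSpace.exists_ultrafilter {L : Signature.{u}} {M : Struct L} {A : M.Subset} {n : ℕ}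
    {Γ : Fin n → L.Srt} (p : TypeSpace A Γ) (N : ModelOver A) :
    ∃ U : Ultrafilter (N.N.Tuple Γ), ∀ ψ : FormulaOver A Γ,
      Filter.Tendsto (fun x => ψ.val N x) U (𝓝 (p.1 ψ)) := by
  obtain ⟨N₁, a, ha⟩ := p.2
  obtain ⟨U, hU⟩ := exists_ultrafilter_tendsto N₁ N a
  refine ⟨U, fun ψ => ?_⟩
  have := hU ψ.toBFormula
  simp only [ψ.eval_toBFormula] at this
  rwa [ha]

/-- An ultrapower of a model realising `q` also realises `p`. Hence the infimum defining the
distance is over a non-empty set and is never the default value `sInf ∅ = 0`. -/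
theorem TypeSpace.exists_common {L : Signature.{u}} {M : Struct L} {A : M.Subset} {n : ℕ}
    {Γ : Fin n → L.Srt} (p q : TypeSpace A Γ) :
    ∃ (N : ModelOver A) (a b : N.N.Tuple Γ), p.Realises N a ∧ q.Realises N b := by
  obtain ⟨N, b, hb⟩ := q.2
  obtain ⟨U, hU⟩ := p.exists_ultrafilter N
  refine ⟨N.upow U, utup U id, utup U fun _ => b, fun ψ => ?_, fun ψ => ?_⟩
  · exact tendsto_nhds_unique (hU ψ) (N.tendsto_val_upow U ψ id)
  · rw [hb]
    exact tendsto_nhds_unique tendsto_const_nhds (N.tendsto_val_upow U ψ fun _ => b)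

theorem TypeSpace.exists_dist_lt {L : Signature.{u}} {M : Struct L} {A : M.Subset} {n : ℕ}
    {Γ : Fin n → L.Srt} {p q : TypeSpace A Γ} {δ : ℝ} (h : p.dist q < δ) :
    ∃ (N : ModelOver A) (a b : N.N.Tuple Γ), p.Realises N a ∧ q.Realises N b ∧
      Dist.dist a b < δ := by
  obtain ⟨N, a, b, ha, hb⟩ := p.exists_common q
  obtain ⟨r, ⟨N, a, b, ha, hb, rfl⟩, hr⟩ := exists_lt_of_csInf_lt
    (s := {r : ℝ | ∃ (N : ModelOver A) (a b : N.N.Tuple Γ),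
      p.Realises N a ∧ q.Realises N b ∧ r = Dist.dist a b}) ⟨_, N, a, b, ha, hb, rfl⟩ h
  exact ⟨N, a, b, ha, hb, hr⟩

theorem TypeSpace.dist_self {L : Signature.{u}} {M : Struct L} {A : M.Subset} {n : ℕ}
    {Γ : Fin n → L.Srt} (p : TypeSpace A Γ) : p.dist p = 0 := by
  have hb : ∀ r ∈ {r : ℝ | ∃ (N : ModelOver A) (a b : N.N.Tuple Γ),
      p.Realises N a ∧ p.Realises N b ∧ r = Dist.dist a b}, 0 ≤ r := by
    rintro _ ⟨N, a, b, -, -, rfl⟩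
    exact dist_nonneg
  obtain ⟨N, a, ha⟩ := p.2
  exact le_antisymm (csInf_le ⟨0, hb⟩ ⟨N, a, a, ha, ha, (_root_.dist_self a).symm⟩)
    (Real.sInf_nonneg hb)

theorem TypeSpace.densityCharacter_le_mk {L : Signature.{u}} {M : Struct L} (A : M.Subset)
    {n : ℕ} (Γ : Fin n → L.Srt) :
    densityCharacter (TypeSpace.dist : TypeSpace A Γ → TypeSpace A Γ → ℝ) ≤
      #(TypeSpace A Γ) :=
  csInf_le' ⟨Set.univ, fun (p : TypeSpace A Γ) ε hε => ⟨p, Set.mem_univ p, by rwa [p.dist_self]⟩,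
    Cardinal.mk_univ.symm⟩

theorem TypeSpace.exists_dense {L : Signature.{u}} {M : Struct L} (A : M.Subset)
    {n : ℕ} (Γ : Fin n → L.Srt) :
    ∃ D : Set (TypeSpace A Γ), (∀ p : TypeSpace A Γ, ∀ ε > 0, ∃ q ∈ D, p.dist q < ε) ∧
      densityCharacter (TypeSpace.dist : TypeSpace A Γ → TypeSpace A Γ → ℝ) = #D :=
  csInf_mem (s := {κ | ∃ D : Set (TypeSpace A Γ),
    (∀ p : TypeSpace A Γ, ∀ ε > 0, ∃ q ∈ D, p.dist q < ε) ∧ κ = #D})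
    ⟨_, Set.univ, fun p ε hε => ⟨p, Set.mem_univ p, by rwa [p.dist_self]⟩, rfl⟩

/-! ### Many types in unstable theories -/

/-- A Ramsey argument by iterated limits along a non-principal ultrafilter: `α` and `β` are the
limits of the row and column limits. Almost every index is close to the limits attached to the
finitely many indices already chosen, so `g` can be built recursively. -/
theorem exists_subseq_limits {F : ℕ → ℕ → ℝ} (hF : ∀ i j, F i j ∈ Set.Icc (0 : ℝ) 1) {δ : ℝ}
    (hδ : 0 < δ) :
    ∃ (α β : ℝ) (g : ℕ → ℕ), ∀ i j, i < j → g i < g j ∧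
      |F (g i) (g j) - α| < δ ∧ |F (g j) (g i) - β| < δ := by
  let V := Filter.hyperfilter ℕ
  have ha := fun i => tendsto_ulim V (f := fun j => F i j) fun j => hF i j
  have hb := fun i => tendsto_ulim V (f := fun j => F j i) fun j => hF j i
  have hα := tendsto_ulim V (f := fun i => ulim V fun j => F i j) fun i =>
    isClosed_Icc.mem_of_tendsto (ha i) (Filter.Eventually.of_forall fun j => hF i j)
  have hβ := tendsto_ulim V (f := fun i => ulim V fun j => F j i) fun i =>
    isClosed_Icc.mem_of_tendsto (hb i) (Filter.Eventually.of_forall fun j => hF j i)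
  set α := ulim V fun i => ulim V fun j => F i j
  set β := ulim V fun i => ulim V fun j => F j i
  have near : ∀ {f : ℕ → ℝ} {l : ℝ}, Filter.Tendsto f V (𝓝 l) → ∀ c, |l - c| < δ →
      ∀ᶠ i in (V : Filter ℕ), |f i - c| < δ := fun hf c hc =>
    (hf.sub_const c).abs.eventually_lt_const hc
  have hV : (V : Filter ℕ).NeBot := V.neBot
  obtain ⟨g, -, hg⟩ := exists_seq_of_forall_finset_exists
    (fun i => |(ulim V fun j => F i j) - α| < δ ∧ |(ulim V fun j => F j i) - β| < δ)
    (fun i j => i < j ∧ |F i j - α| < δ ∧ |F j i - β| < δ) (fun s hs => by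
      have h1 := (near hα α (by simpa using hδ)).and (near hβ β (by simpa using hδ))
      have h2 : ∀ᶠ j in (V : Filter ℕ), ∀ i ∈ s, i < j ∧ |F i j - α| < δ ∧ |F j i - β| < δ :=
        (Finset.eventually_all _).2 fun i hi =>
          (Filter.Eventually.filter_mono Nat.hyperfilter_le_atTop
            (Filter.eventually_gt_atTop i)).and <|
          (near (ha i) α (hs i hi).1).and (near (hb i) β (hs i hi).2)
      exact (h1.and h2).exists)
  exact ⟨α, β, g, hg⟩

theorem exists_chain {L : Signature.{u}} {T : Theory L} {n m : ℕ} {Γ : Fin n → L.Srt}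
    {Δ : Fin m → L.Srt} (φ : Formula L (Sum.elim Γ Δ)) {M : Struct L} (hM : M.Models T)
    {a : ℕ → M.Tuple Γ} {b : ℕ → M.Tuple Δ} {α β δ : ℝ}
    (h : ∀ i j, i < j → |φ.val M (M.join (a i) (b j)) - α| < δ ∧
      |φ.val M (M.join (a j) (b i)) - β| < δ) (J : Type u) [LinearOrder J] :
    ∃ (N : Struct L) (a' : J → N.Tuple Γ) (b' : J → N.Tuple Δ), N.Models T ∧
      ∀ i j, i < j → |φ.val N (N.join (a' i) (b' j)) - α| ≤ δ ∧
        |φ.val N (N.join (a' j) (b' i)) - β| ≤ δ := by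
  classical
  -- The ultrapower is indexed by maps `J → ℕ`, with an ultrafilter for which almost all maps
  -- increase strictly on any given finite set. The element at `i` is the class of `g ↦ a (g i)`.
  let S : Finset J → Set (J → ℕ) := fun F => {g | StrictMonoOn g F}
  have hne : ∀ F, (S F).Nonempty := by
    refine fun F => ⟨fun i => (F.filter (· < i)).card, fun i hi j hj hij => ?_⟩
    refine Finset.card_lt_card (Finset.ssubset_iff_of_subset ?_ |>.2 ⟨i, ?_, ?_⟩)
    · exact fun k hk => by
        rw [Finset.mem_filter] at hk ⊢
        exact ⟨hk.1, hk.2.trans hij⟩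
    · exact Finset.mem_filter.2 ⟨hi, hij⟩
    · simp
  have hdir : Directed (· ≥ ·) fun F => Filter.principal (S F) := fun F F' =>
    ⟨F ∪ F', Filter.principal_mono.2 fun g hg => hg.mono (by simp),
      Filter.principal_mono.2 fun g hg => hg.mono (by simp)⟩
  have hbot : (⨅ F, Filter.principal (S F)).NeBot :=
    Filter.iInf_neBot_of_directed hdir fun F => Filter.principal_neBot_iff.2 (hne F)
  let U := Ultrafilter.of (⨅ F, Filter.principal (S F))
  have hU : ∀ i j, i < j → ∀ᶠ g in (U : Filter (J → ℕ)), g i < g j := by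
    intro i j hij
    have : S {i, j} ∈ (U : Filter (J → ℕ)) := Ultrafilter.of_le _
      (Filter.mem_iInf_of_mem _ (Filter.mem_principal_self _))
    filter_upwards [this] with g hg
    exact hg (by simp) (by simp) hij
  have hlim : ∀ i j, Filter.Tendsto (fun g : J → ℕ => φ.val M (M.join (a (g i)) (b (g j)))) U
      (𝓝 (φ.val (ultra U fun _ => M) ((ultra U fun _ => M).join
        (utup U fun g => a (g i)) (utup U fun g => b (g j))))) := by
    intro i j
    rw [join_utup]
    exact tendsto_val_ultra U (M := fun _ => M) φ fun g => M.join (a (g i)) (b (g j))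
  refine ⟨ultra U fun _ => M, fun i => utup U fun g => a (g i), fun i => utup U fun g => b (g i),
    ultra_models U fun _ => hM, fun i j hij => ⟨?_, ?_⟩⟩
  · exact le_of_tendsto ((hlim i j).sub_const α).abs
      ((hU i j hij).mono fun g hg => (h _ _ hg).1.le)
  · exact le_of_tendsto ((hlim j i).sub_const β).abs
      ((hU i j hij).mono fun g hg => (h _ _ hg).2.le)

/-- For every infinite `κ` there is a linear order with a set of at most `κ` points separating
more than `κ` points. -/
theorem exists_linearOrder_separating (κ : Cardinal.{u}) (hκ : ℵ₀ ≤ κ) :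
    ∃ (J X Y : Type u) (_ : LinearOrder J) (t : X → J) (k : Y → J), κ < #X ∧ #Y ≤ κ ∧
      ∀ x x', x ≠ x' → ∃ y, t x < k y ∧ k y < t x' ∨ t x' < k y ∧ k y < t x := by
  classical
  -- For the least such `μ`, the binary tree of height `μ` has more than `κ` branches, but at most
  -- `μ * κ ≤ κ` nodes.
  let s : Set Cardinal.{u} := {μ | κ < 2 ^ μ}
  have hs : κ ∈ s := Cardinal.cantor κ
  have hμ : κ < 2 ^ sInf s := csInf_mem ⟨κ, hs⟩
  have hμκ : sInf s ≤ κ := csInf_le' hs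
  have hlt : ∀ ν < sInf s, 2 ^ ν ≤ κ := fun ν hν =>
    not_lt.1 (show ν ∉ s from notMem_of_lt_csInf' hν)
  set μ := sInf s
  let O := μ.ord.ToType
  -- Branches use the digits `0` and `2`; a node is its path followed by digits `1`. Where two
  -- branches first differ, the node at which they split lies strictly between them.
  let t : (O → Bool) → Lex (O → Fin 3) := fun f => toLex fun η => if f η then 2 else 0
  let k : (Σ ξ : O, Set.Iio ξ → Bool) → Lex (O → Fin 3) := fun d => toLex fun η =>
    if h : η < d.1 then if d.2 ⟨η, h⟩ then 2 else 0 else 1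
  have key : ∀ f f' : O → Bool, ∀ ξ, (∀ η < ξ, f η = f' η) → f ξ = false → f' ξ = true →
      t f < k ⟨ξ, fun η => f η⟩ ∧ k ⟨ξ, fun η => f η⟩ < t f' := by
    intro f f' ξ h h0 h1
    refine ⟨⟨ξ, fun η hη => ?_, ?_⟩, ⟨ξ, fun η hη => ?_, ?_⟩⟩
    · simp [t, k, show η < ξ from hη]
    · simp [t, k, h0]
    · simp [t, k, show η < ξ from hη, h η hη]
    · simp [t, k, h1]
  refine ⟨Lex (O → Fin 3), O → Bool, Σ ξ : O, Set.Iio ξ → Bool, inferInstance, t, k, ?_, ?_, ?_⟩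
  · simpa [O] using hμ
  · rw [Cardinal.mk_sigma]
    calc Cardinal.sum (fun ξ : O => #(Set.Iio ξ → Bool)) ≤ Cardinal.sum fun _ : O => κ := by
          refine Cardinal.sum_le_sum _ _ fun ξ => ?_
          have h := Cardinal.mk_Iio_lt ξ (by simp [O])
          have := hlt _ (h.trans_eq (Cardinal.mk_ord_toType μ))
          simpa using this
      _ = μ * κ := by simp [O]
      _ ≤ κ := Cardinal.mul_le_of_le hκ hμκ le_rfl
  · intro f f' hff
    have hne : {ξ | f ξ ≠ f' ξ}.Nonempty := Function.ne_iff.1 hff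
    have hwf : WellFounded ((· < ·) : O → O → Prop) := wellFounded_lt
    have h1 := hwf.min_mem _ hne
    have h2 : ∀ η < hwf.min _ hne, f η = f' η := fun η hη => by
      by_contra h
      exact hwf.not_lt_min _ h hη
    set ξ := hwf.min _ hne
    rcases Bool.eq_false_or_eq_true (f ξ) with h3 | h3
    · have h4 : f' ξ = false := by
        rcases Bool.eq_false_or_eq_true (f' ξ) with h | h
        · exact absurd (h3.trans h.symm) h1
        · exact h
      exact ⟨_, Or.inr (key f' f ξ (fun η hη => (h2 η hη).symm) h4 h3)⟩
    · have h4 : f' ξ = true := by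
        rcases Bool.eq_false_or_eq_true (f' ξ) with h | h
        · exact h
        · exact absurd (h3.trans h.symm) h1
      exact ⟨_, Or.inl (key f f' ξ h2 h3 h4)⟩

/-- Uniform continuity of `φ`, applied to nearby realisations in a common model. The same `δ` serves
all structures and parameter sets, so it can be fixed before the density argument. -/
theorem TypeSpace.abs_sub_le_of_dist_lt {L : Signature.{u}} {n m : ℕ} {Γ : Fin n → L.Srt}
    {Δ : Fin m → L.Srt} (φ : Formula L (Sum.elim Γ Δ)) {ε : ℝ} (hε : 0 < ε) :
    ∃ δ > 0, ∀ (M : Struct L) (A : M.Subset) (b : (j : Fin m) → A (Δ j)) (p q : TypeSpace A Γ),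
      p.dist q < δ → |p.1 ⟨m, Δ, φ, b⟩ - q.1 ⟨m, Δ, φ, b⟩| ≤ ε := by
  obtain ⟨δ, hδ, h0⟩ := ((φ.eval_uniform hε).and self_mem_nhdsWithin).exists
  have h0 : 0 < δ := h0
  refine ⟨δ, h0, fun M A b p q hpq => ?_⟩
  obtain ⟨N, x, y, hx, hy, hxy⟩ := p.exists_dist_lt hpq
  rw [hx, hy]
  refine hδ N.N _ _ _ _ ?_ fun i => i.elim0
  rintro (i | j)
  · exact (dist_pi_lt_iff h0).1 hxy i
  · exact (_root_.dist_self _).trans_lt h0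

theorem Theory.IsCardStable.isStable {L : Signature.{u}} {T : Theory L} {κ : Cardinal.{u}}
    (hκ : ℵ₀ ≤ κ) (h : T.IsCardStable κ) : T.IsStable := by
  rintro n m Γ Δ φ ε hε M hM ⟨a, b, hab⟩
  have hε8 : 0 < ε / 8 := by positivity
  obtain ⟨α, β, g, hg⟩ := exists_subseq_limits
    (F := fun i j => φ.val M (M.join (a i) (b j))) (fun i j => φ.eval_mem M _ _) hε8
  -- The two values differ by at least `ε`, and each is within `ε / 8` of its constant.
  have hαβ : ε * 3 / 4 ≤ |α - β| := by
    obtain ⟨h0, h1, h2⟩ := hg 0 1 one_pos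
    have h3 := hab _ _ h0
    rw [abs_lt] at h1 h2
    rcases le_abs.1 h3 with h3 | h3
    · exact le_abs.2 (Or.inl (by linarith [h1.1, h1.2, h2.1, h2.2]))
    · exact le_abs.2 (Or.inr (by linarith [h1.1, h1.2, h2.1, h2.2]))
  obtain ⟨J, X, Y, _, t, k, hX, hY, hsep⟩ := exists_linearOrder_separating κ hκ
  obtain ⟨N, a', b', hN, hN'⟩ := exists_chain φ hM (fun i j hij => (hg i j hij).2) J
  let A : N.Subset := fun s =>
    {x | ∃ (d : Y) (l : Fin m), (⟨s, x⟩ : Σ s, N.Carrier s) = ⟨Δ l, b' (k d) l⟩}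
  have hA : #(Σ s, A s) ≤ κ := by
    have hsurj : Function.Surjective
        (fun d : Y × Fin m => (⟨Δ d.2, b' (k d.1) d.2, d.1, d.2, rfl⟩ : Σ s, A s)) := by
      rintro ⟨s, x, d, l, hdl⟩
      cases hdl
      exact ⟨(d, l), rfl⟩
    have h2 := Cardinal.mk_le_of_surjective (f := fun d : Y × ULift.{u} (Fin m) =>
        (⟨Δ d.2.down, b' (k d.1) d.2.down, d.1, d.2.down, rfl⟩ : Σ s, A s)) (fun x => by
      obtain ⟨⟨d, l⟩, h⟩ := hsurj x
      exact ⟨(d, ⟨l⟩), h⟩)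
    refine h2.trans ?_
    rw [Cardinal.mk_prod, Cardinal.lift_id, Cardinal.lift_id]
    exact Cardinal.mul_le_of_le hκ hY ((Cardinal.lt_aleph0_of_finite _).le.trans hκ)
  obtain ⟨δ, hδ, hδ'⟩ := TypeSpace.abs_sub_le_of_dist_lt φ hε8
  obtain ⟨D, hD, hDκ⟩ := TypeSpace.exists_dense A Γ
  have hDκ : #D ≤ κ := hDκ ▸ h N hN A hA n Γ
  let p : X → TypeSpace A Γ := fun x => (ModelOver.self A).typeOf (a' (t x))
  choose q hqD hq using fun x => hD (p x) δ hδ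
  -- Pigeonhole: two of the more than `κ` branches get the same nearby point of the dense set.
  have hinj : ¬ Function.Injective (fun x => (⟨q x, hqD x⟩ : D)) := fun hinj =>
    (hX.trans_le (Cardinal.mk_le_of_injective hinj)).not_ge hDκ
  simp only [Function.Injective, not_forall] at hinj
  obtain ⟨x, x', hxx, hne⟩ := hinj
  have hqq : q x = q x' := congrArg Subtype.val hxx
  obtain ⟨y, hy⟩ := hsep x x' hne
  let c : (l : Fin m) → A (Δ l) := fun l => ⟨b' (k y) l, y, l, rfl⟩
  have h1 := hδ' N A c _ _ (hq x)
  have h2 := hδ' N A c _ _ (hq x')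
  rw [← hqq] at h2
  have hp : ∀ x, (p x).1 ⟨m, Δ, φ, c⟩ = φ.val N (N.join (a' (t x)) (b' (k y))) := fun _ => rfl
  rw [hp] at h1 h2
  simp only [abs_le] at h1 h2 hN'
  rcases hy with ⟨h3, h4⟩ | ⟨h3, h4⟩
  · have h5 := (hN' _ _ h3).1
    have h6 := (hN' _ _ h4).2
    -- Four errors of `ε / 8`: two from the chain and two from the distance to the common type.
    have : |α - β| ≤ ε / 2 := abs_le.2
      ⟨by linarith [h1.1, h1.2, h2.1, h2.2, h5.1, h5.2, h6.1, h6.2],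
       by linarith [h1.1, h1.2, h2.1, h2.2, h5.1, h5.2, h6.1, h6.2]⟩
    linarith
  · have h5 := (hN' _ _ h3).1
    have h6 := (hN' _ _ h4).2
    have : |α - β| ≤ ε / 2 := abs_le.2
      ⟨by linarith [h1.1, h1.2, h2.1, h2.2, h5.1, h5.2, h6.1, h6.2],
       by linarith [h1.1, h1.2, h2.1, h2.2, h5.1, h5.2, h6.1, h6.2]⟩
    linarith

/-! ### Definability of types in stable theories -/

/-- The `N`-th largest of the values of a list of formulae (`1` if `N = 0`, and `0` if there are
fewer than `N` of them). -/
def BFormula.nthLargest {L : Signature.{u}} {α : Type*} {σ : α → L.Srt} {n : ℕ}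
    {Γ : Fin n → L.Srt} (φ : BFormula L σ n Γ) : ℕ → List (BFormula L σ n Γ) → BFormula L σ n Γ
  | 0, _ => .neg (.dotminus φ φ)
  | _ + 1, [] => .dotminus φ φ
  | N + 1, χ :: l => (nthLargest φ (N + 1) l).max ((nthLargest φ N l).min χ)

theorem BFormula.le_eval_nthLargest_iff {L : Signature.{u}} {α : Type*} {σ : α → L.Srt} {n : ℕ}
    {Γ : Fin n → L.Srt} (φ : BFormula L σ n Γ) (M : Struct L) (v : M.Tuple σ) (w : M.Tuple Γ)
    {t : ℝ} (h0 : 0 < t) (h1 : t ≤ 1) (N : ℕ) (l : List (BFormula L σ n Γ)) :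
    t ≤ (φ.nthLargest N l).eval M v w ↔ N ≤ l.countP fun χ => t ≤ χ.eval M v w := by
  induction l generalizing N with
  | nil =>
    cases N with
    | zero => simpa [nthLargest, BFormula.eval] using h1
    | succ N => simpa [nthLargest, BFormula.eval] using h0
  | cons χ l ih =>
    cases N with
    | zero => simpa [nthLargest, BFormula.eval] using h1
    | succ N =>
      rw [nthLargest, eval_max, eval_min, le_max_iff, le_min_iff, ih, ih, List.countP_cons]
      by_cases h : t ≤ χ.eval M v w
      · simp only [h, and_true, decide_true, if_true]
        omega
      · simp [h]

/-- Each element of the list `l` approximates `f` at the points `β s`, for the sublists `s` of the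
remaining list. -/
def IsApproxList {A B : Type*} (Φ : A → B → ℝ) (f : B → ℝ) (β : List A → B) (η : ℝ) :
    List A → Prop
  | [] => True
  | a :: l => (∀ s, s.Sublist l → |Φ a (β s) - f (β s)| < η) ∧ IsApproxList Φ f β η l

theorem IsApproxList.sublist {A B : Type*} {Φ : A → B → ℝ} {f : B → ℝ} {β : List A → B} {η : ℝ}
    {l l' : List A} (h : IsApproxList Φ f β η l) (hl : l'.Sublist l) :
    IsApproxList Φ f β η l' := by
  induction hl with
  | slnil => exact h
  | cons a _ ih => exact ih h.2
  | cons_cons a hs ih => exact ⟨fun s hs' => h.1 s (hs'.trans hs), ih h.2⟩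

/-- A configuration of length `N` which is excluded by stability for large `N`. -/
def IsLadder {A B : Type*} (Φ : A → B → ℝ) (ε : ℝ) (N : ℕ) (a : ℕ → A) (b : ℕ → B)
    (γ : ℕ → ℝ) : Prop :=
  ∀ j < N, ∀ k < N, (j < k → Φ (a j) (b k) ≤ γ k - ε) ∧ (k ≤ j → γ k - ε / 4 ≤ Φ (a j) (b k))

theorem IsApproxList.exists_ladder {A B : Type*} [Nonempty A] {Φ : A → B → ℝ} {f : B → ℝ}
    {β : List A → B} {ε : ℝ}
    (hβ : ∀ l, (∃ b, ∀ a ∈ l, Φ a b ≤ f b - ε) → ∀ a ∈ l, Φ a (β l) ≤ f (β l) - ε)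
    {l : List A} (h : IsApproxList Φ f β (ε / 4) l) {b : B} (hb : ∀ a ∈ l, Φ a b ≤ f b - ε) :
    ∃ a b, IsLadder Φ ε l.length a b fun k => f (b k) := by
  -- The induction must remember that each `a j` lies in `l` and each `b k` is a test point of a
  -- sublist. Then the new point `β l` is low for all old `a j`, while the new head is nearly exact
  -- at all old `b k`.
  suffices H : ∃ (a : ℕ → A) (b : ℕ → B), IsLadder Φ ε l.length a b (fun k => f (b k)) ∧
      (∀ j < l.length, a j ∈ l) ∧ ∀ k < l.length, ∃ s, s.Sublist l ∧ b k = β s by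
    obtain ⟨a, b, h, -⟩ := H
    exact ⟨a, b, h⟩
  induction l with
  | nil => exact ⟨fun _ => Classical.arbitrary A, fun _ => b, fun j hj => absurd hj (by simp),
      fun j hj => absurd hj (by simp), fun j hj => absurd hj (by simp)⟩
  | cons x l ih =>
    have hb' : ∀ a ∈ l, Φ a b ≤ f b - ε := fun a ha => hb a (List.mem_cons_of_mem _ ha)
    obtain ⟨a, c, h1, h2, h3⟩ := ih h.2 hb'
    have hlt : ∀ {j}, j < (x :: l).length → j ≠ l.length → j < l.length := fun hj hne => by
      rw [List.length_cons] at hj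
      omega
    refine ⟨Function.update a l.length x, Function.update c l.length (β l), ?_, ?_, ?_⟩
    · intro j hj k hk
      beta_reduce
      by_cases hjl : j = l.length
      · subst hjl
        rw [Function.update_self]
        by_cases hkl : k = l.length
        · subst hkl
          rw [Function.update_self]
          exact ⟨fun h => absurd h (lt_irrefl _),
            fun _ => by linarith [(abs_lt.1 (h.1 l (List.Sublist.refl l))).1]⟩
        · have hk' := hlt hk hkl
          rw [Function.update_of_ne hkl]
          obtain ⟨s, hs, hcs⟩ := h3 k hk'
          rw [hcs]
          exact ⟨fun h => absurd h hk'.not_gt, fun _ => by linarith [(abs_lt.1 (h.1 s hs)).1]⟩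
      · have hj' := hlt hj hjl
        rw [Function.update_of_ne hjl]
        by_cases hkl : k = l.length
        · subst hkl
          rw [Function.update_self]
          exact ⟨fun _ => hβ l ⟨b, hb'⟩ _ (h2 j hj'), fun h => absurd h hj'.not_ge⟩
        · rw [Function.update_of_ne hkl]
          exact h1 j hj' k (hlt hk hkl)
    · intro j hj
      by_cases hjl : j = l.length
      · subst hjl
        rw [Function.update_self]
        exact List.mem_cons_self
      · rw [Function.update_of_ne hjl]
        exact List.mem_cons_of_mem _ (h2 j (hlt hj hjl))
    · intro k hk
      by_cases hkl : k = l.length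
      · subst hkl
        rw [Function.update_self]
        exact ⟨l, List.sublist_cons_self x l, rfl⟩
      · rw [Function.update_of_ne hkl]
        obtain ⟨s, hs, hcs⟩ := h3 k (hlt hk hkl)
        exact ⟨s, hs.trans (List.sublist_cons_self x l), hcs⟩

/-- Ladders of unbounded length give an infinite one in an ultrapower. On a subsequence along which
the thresholds `γ` converge, it is an instability pattern. -/
theorem IsStableFormula.exists_no_ladder {L : Signature.{u}} {T : Theory L} {n m : ℕ}
    {Γ : Fin n → L.Srt} {Δ : Fin m → L.Srt} {φ : Formula L (Sum.elim Γ Δ)}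
    (hφ : IsStableFormula T φ) {M : Struct L} (hM : M.Models T) {ε : ℝ} (hε : 0 < ε) :
    ∃ N, ∀ K, N ≤ K → ∀ (a : ℕ → M.Tuple Γ) (b : ℕ → M.Tuple Δ) (γ : ℕ → ℝ),
      (∀ k, γ k ∈ Set.Icc (0 : ℝ) 1) →
        ¬ IsLadder (fun a b => φ.val M (M.join a b)) ε K a b γ := by
  by_contra! hcon
  choose K hK a b γ hγ hl using hcon
  -- The index type is lifted because `ultra` needs it in `Type u`.
  let U := Filter.hyperfilter (ULift.{u} ℕ)
  let N := ultra U fun _ => M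
  let a' : ℕ → N.Tuple Γ := fun j => utup U fun i => a i.down j
  let b' : ℕ → N.Tuple Δ := fun j => utup U fun i => b i.down j
  let γ' : ℕ → ℝ := fun j => ulim U fun i => γ i.down j
  have hγ' := fun j => tendsto_ulim U (f := fun i => γ i.down j) fun i => hγ i.down j
  have hmem : ∀ j, γ' j ∈ Set.Icc (0 : ℝ) 1 := fun j =>
    isClosed_Icc.mem_of_tendsto (hγ' j) (Filter.Eventually.of_forall fun i => hγ i.down j)
  have hlim : ∀ j k, Filter.Tendsto
      (fun i : ULift.{u} ℕ => φ.val M (M.join (a i.down j) (b i.down k))) U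
      (𝓝 (φ.val N (N.join (a' j) (b' k)))) := by
    intro j k
    have := tendsto_val_ultra U (M := fun _ => M) φ fun i => M.join (a i.down j) (b i.down k)
    rwa [← join_utup] at this
  have hev : ∀ j : ℕ, ∀ᶠ i in (U : Filter (ULift.{u} ℕ)), j < i.down := by
    intro j
    refine Filter.hyperfilter_le_cofinite (Filter.mem_cofinite.2 ?_)
    refine ((Set.finite_Iic j).preimage ULift.down_injective.injOn).subset fun i hi => ?_
    exact not_lt.1 (show ¬ j < i.down from hi)
  have h1 : ∀ j k, j < k → φ.val N (N.join (a' j) (b' k)) ≤ γ' k - ε := fun j k hjk => by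
    refine le_of_tendsto_of_tendsto (hlim j k) ((hγ' k).sub_const ε) ?_
    filter_upwards [hev k] with i hi
    have hi' := hi.trans_le (hK i.down)
    exact (hl i.down j (hjk.trans hi') k hi').1 hjk
  have h2 : ∀ j k, k ≤ j → γ' k - ε / 4 ≤ φ.val N (N.join (a' j) (b' k)) := fun j k hjk => by
    refine le_of_tendsto_of_tendsto ((hγ' k).sub_const (ε / 4)) (hlim j k) ?_
    filter_upwards [hev j] with i hi
    have hi' := hi.trans_le (hK i.down)
    exact (hl i.down j hi' k (hjk.trans_lt hi')).2 hjk
  obtain ⟨c, -, g, hg, hc⟩ := isCompact_Icc.tendsto_subseq hmem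
  have hε8 : 0 < ε / 8 := by positivity
  obtain ⟨i₀, hi₀⟩ := Filter.eventually_atTop.1 (Metric.tendsto_nhds.1 hc _ hε8)
  -- The gap is `ε - ε / 4` relative to thresholds that differ by less than `2 * (ε / 8)`, which
  -- leaves `ε / 2`.
  refine hφ (ε / 2) (half_pos hε) N (ultra_models U fun _ => hM)
    ⟨fun i => a' (g (i + i₀)), fun i => b' (g (i + i₀)), fun i j hij => ?_⟩
  have hlt : g (i + i₀) < g (j + i₀) := hg (by omega)
  have h3 := h1 _ _ hlt
  have h4 := h2 _ _ hlt.le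
  have h5 := hi₀ (i + i₀) (by omega)
  have h6 := hi₀ (j + i₀) (by omega)
  rw [Real.dist_eq, Function.comp, abs_lt] at h5 h6
  exact le_abs.2 (Or.inr (by linarith [h5.1, h5.2, h6.1, h6.2]))

/-- A list has finitely many sublists, so each new element has only finitely many points to satisfy.
One list serves both test functions, so that deviations below and above `f` are controlled together.
All sublists are included because the deviating elements depend on the later choice of `b`. -/
theorem exists_approxList {A B : Type*} {Φ : A → B → ℝ} {f : B → ℝ} {η : ℝ}
    (h : ∀ l : List B, ∃ a, ∀ b ∈ l, |Φ a b - f b| < η) (β₁ β₂ : List A → B) (n : ℕ) :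
    ∃ l : List A, l.length = n ∧ IsApproxList Φ f β₁ η l ∧
      IsApproxList (fun a b => 1 - Φ a b) (fun b => 1 - f b) β₂ η l := by
  induction n with
  | zero => exact ⟨[], rfl, trivial, trivial⟩
  | succ n ih =>
    obtain ⟨l, hl, h1, h2⟩ := ih
    obtain ⟨a, ha⟩ := h (l.sublists.map β₁ ++ l.sublists.map β₂)
    refine ⟨a :: l, by simp [hl], ⟨fun s hs => ha _ ?_, h1⟩, ⟨fun s hs => ?_, h2⟩⟩
    · exact List.mem_append_left _ (List.mem_map_of_mem (List.mem_sublists.2 hs))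
    · rw [sub_sub_sub_cancel_left, abs_sub_comm]
      exact ha _ (List.mem_append_right _ (List.mem_map_of_mem (List.mem_sublists.2 hs)))

/-- The formula `φ(ā, ȳ)` for `ā` in `M`. -/
def Formula.plugLeft {L : Signature.{u}} {M : Struct L} {n m : ℕ} {Γ : Fin n → L.Srt}
    {Δ : Fin m → L.Srt} (φ : Formula L (Sum.elim Γ Δ)) (a : M.Tuple Γ) :
    BFormula L M.all.sort m Δ :=
  φ.subst fun
    | .inl (.inl i) => .var (σ := Sum.elim M.all.sort Δ) (.inl ⟨Γ i, a i, Set.mem_univ _⟩)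
    | .inl (.inr j) => .var (σ := Sum.elim M.all.sort Δ) (.inr j)
    | .inr i => i.elim0

theorem Formula.eval_plugLeft {L : Signature.{u}} {M : Struct L} {n m : ℕ} {Γ : Fin n → L.Srt}
    {Δ : Fin m → L.Srt} (φ : Formula L (Sum.elim Γ Δ)) (a : M.Tuple Γ) (b : M.Tuple Δ) :
    (φ.plugLeft a).eval M (ModelOver.self M.all).params b = φ.val M (M.join a b) := by
  refine BFormula.eval_subst M φ _ ?_
  rintro ((i | j) | i)
  · rfl
  · rfl
  · exact i.elim0

theorem TypeSpace.val_mem {L : Signature.{u}} {M : Struct L} {A : M.Subset} {n : ℕ}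
    {Γ : Fin n → L.Srt} (p : TypeSpace A Γ) (ψ : FormulaOver A Γ) :
    p.1 ψ ∈ Set.Icc (0 : ℝ) 1 := by
  obtain ⟨N, a, h⟩ := p.2
  rw [h]
  exact ψ.φ.eval_mem _ _ _

/-- Among `2 * N` suitably chosen `a`, fewer than `N` values `φ(a, b)` are too low and fewer than
`N` too high, whatever `b` is. The `N`-th largest value is therefore a good approximation. -/
theorem Theory.IsStable.exists_formulaOver_approx {L : Signature.{u}} {T : Theory L}
    (hT : T.IsStable) {M : Struct L} (hM : M.Models T) {n m : ℕ} {Γ : Fin n → L.Srt}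
    {Δ : Fin m → L.Srt} (p : TypeSpace M.all Γ) (φ : Formula L (Sum.elim Γ Δ)) {ε : ℝ}
    (hε : 0 < ε) :
    ∃ χ : FormulaOver M.all Δ, ∀ b : M.Tuple Δ,
      |χ.val (ModelOver.self M.all) b - p.1 (instanceOver φ b)| ≤ ε := by
  classical
  let Φ : M.Tuple Γ → M.Tuple Δ → ℝ := fun a b => φ.val M (M.join a b)
  let f : M.Tuple Δ → ℝ := fun b => p.1 (instanceOver φ b)
  have hf : ∀ b, f b ∈ Set.Icc (0 : ℝ) 1 := fun b => p.val_mem _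
  have happ : ∀ l : List (M.Tuple Δ), ∃ a, ∀ b ∈ l, |Φ a b - f b| < ε / 4 := by
    intro l
    obtain ⟨U, hU⟩ : ∃ U : Ultrafilter (M.Tuple Γ), ∀ ψ : FormulaOver M.all Γ,
        Filter.Tendsto (fun x : M.Tuple Γ => ψ.val (ModelOver.self M.all) x) U (𝓝 (p.1 ψ)) :=
      p.exists_ultrafilter (ModelOver.self M.all)
    have : ∀ᶠ a in (U : Filter (M.Tuple Γ)), ∀ b ∈ {b | b ∈ l}, |Φ a b - f b| < ε / 4 :=
      (Filter.eventually_all_finite l.finite_toSet).2 fun b _ =>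
        (Metric.tendsto_nhds.1 (hU (instanceOver φ b)) _ (by positivity))
    exact this.exists
  have hN₁ := (hT n m Γ Δ φ).exists_no_ladder hM hε
  have hN₂ := (hT n m Γ Δ (.neg φ)).exists_no_ladder hM hε
  obtain ⟨N₁, hN₁⟩ := hN₁
  obtain ⟨N₂, hN₂⟩ := hN₂
  let N := max N₁ N₂
  let P₁ : List (M.Tuple Γ) → M.Tuple Δ → Prop := fun l b => ∀ a ∈ l, Φ a b ≤ f b - ε
  let P₂ : List (M.Tuple Γ) → M.Tuple Δ → Prop := fun l b => ∀ a ∈ l, 1 - Φ a b ≤ 1 - f b - ε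
  -- The test point of a list is a common point of deviation if there is one; otherwise it is
  -- arbitrary, and its value is harmless.
  obtain ⟨l, hl, h1, h2⟩ := exists_approxList happ (fun l => Classical.epsilon (P₁ l))
    (fun l => Classical.epsilon (P₂ l)) (2 * N)
  have hc₁ : ∀ b, l.countP (fun a => Φ a b ≤ f b - ε) < N := by
    intro b
    by_contra! hlt
    rw [List.countP_eq_length_filter] at hlt
    obtain ⟨a, c, h⟩ := (h1.sublist List.filter_sublist).exists_ladder
      (fun l h => Classical.epsilon_spec (p := P₁ l) h)
      (l := l.filter fun a => Φ a b ≤ f b - ε) (b := b) (fun a ha => by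
        simpa using (List.mem_filter.1 ha).2)
    exact hN₁ _ ((le_max_left _ _).trans hlt) a c _ (fun k => hf (c k)) h
  have hc₂ : ∀ b, l.countP (fun a => f b + ε ≤ Φ a b) < N := by
    intro b
    by_contra! hlt
    rw [List.countP_eq_length_filter] at hlt
    obtain ⟨a, c, h⟩ := (h2.sublist List.filter_sublist).exists_ladder
      (fun l h => Classical.epsilon_spec (p := P₂ l) h)
      (l := l.filter fun a => f b + ε ≤ Φ a b) (b := b) (fun a ha => by
        have := (List.mem_filter.1 ha).2
        rw [decide_eq_true_eq] at this
        linarith)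
    exact hN₂ _ ((le_max_right _ _).trans hlt) a c _
      (fun k => ⟨by linarith [(hf (c k)).2], by linarith [(hf (c k)).1]⟩) h
  obtain ⟨χ, hχ⟩ := exists_formulaOver (A := M.all) ((φ.plugLeft
    (Classical.arbitrary (M.Tuple Γ))).nthLargest N (l.map φ.plugLeft))
  refine ⟨χ, fun b => ?_⟩
  rw [hχ (ModelOver.self M.all) b]
  have hmem := BFormula.eval_mem M (ModelOver.self M.all).params ((φ.plugLeft
    (Classical.arbitrary (M.Tuple Γ))).nthLargest N (l.map φ.plugLeft)) b
  have hiff := fun t h0 h1 => BFormula.le_eval_nthLargest_iff (t := t)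
    (φ.plugLeft (Classical.arbitrary (M.Tuple Γ))) M (ModelOver.self M.all).params b h0 h1 N
    (l.map φ.plugLeft)
  simp only [List.countP_map, Function.comp_def, Formula.eval_plugLeft] at hiff
  change |BFormula.eval M (ModelOver.self M.all).params ((φ.plugLeft
    (Classical.arbitrary (M.Tuple Γ))).nthLargest N (l.map φ.plugLeft)) b - f b| ≤ ε
  set r := BFormula.eval M (ModelOver.self M.all).params ((φ.plugLeft
    (Classical.arbitrary (M.Tuple Γ))).nthLargest N (l.map φ.plugLeft)) b
  have hfb := hf b
  refine abs_le.2 ⟨?_, ?_⟩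
  · by_contra! hlt
    have h3 : ¬ f b - ε ≤ r := by linarith
    rw [hiff _ (by linarith [hmem.1]) (by linarith [hfb.2])] at h3
    -- Each of the `2 * N` values is at most or at least `f b - ε`, but fewer than `N` are of either
    -- kind.
    have h4 := List.length_eq_countP_add_countP (fun a => decide (Φ a b ≤ f b - ε)) (l := l)
    have h5 : l.countP (fun a => ¬ decide (Φ a b ≤ f b - ε)) ≤
        l.countP fun a => f b - ε ≤ Φ a b := List.countP_mono_left fun a _ ha => by
      simp only [decide_eq_true_eq, not_le] at ha ⊢
      exact ha.le
    have h6 := hc₁ b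
    have h7 : l.countP (fun a => f b - ε ≤ Φ a b) < N := not_le.1 h3
    omega
  · by_contra! hlt
    have h3 := (hiff r (by linarith [hfb.1]) hmem.2).1 le_rfl
    refine (h3.trans (List.countP_mono_left fun a _ ha => ?_)).not_gt (hc₂ b)
    simp only [decide_eq_true_eq] at ha ⊢
    exact le_trans (by linarith) ha

/-- Consecutive terms differ by at most `2⁻ᵏ⁻² + 2⁻ᵏ⁻³ ≤ 2⁻ᵏ⁻¹`, so the forcing never alters the
sequence. -/
theorem isForcedLim_of_abs_sub_le {a : ℕ → ℝ} {l : ℝ} (h : ∀ k, |a k - l| ≤ (1 / 2) ^ (k + 2)) :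
    IsForcedLim a l := by
  have h1 : forcedSeq a = a := by
    funext k
    induction k with
    | zero => rfl
    | succ k ih =>
      have h2 := abs_le.1 (h k)
      have h3 := abs_le.1 (h (k + 1))
      have h4 : (1 / 2 : ℝ) ^ (k + 2) + (1 / 2) ^ (k + 1 + 2) ≤ (1 / 2) ^ (k + 1) := by
        have : (0 : ℝ) < (1 / 2) ^ k := by positivity
        ring_nf
        linarith
      rw [forcedSeq, ih, min_eq_left (by linarith [h2.1, h3.2]),
        max_eq_right (by linarith [h2.2, h3.1])]
  rw [IsForcedLim, h1, tendsto_iff_dist_tendsto_zero]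
  refine squeeze_zero (fun _ => dist_nonneg) (fun k => h k) ?_
  exact (Filter.tendsto_add_atTop_iff_nat 2).2
    (tendsto_pow_atTop_nhds_zero_of_lt_one (r := (1 / 2 : ℝ)) (by norm_num) (by norm_num))

theorem Theory.IsStable.isDefinable {L : Signature.{u}} {T : Theory L} (hT : T.IsStable)
    {M : Struct L} (hM : M.Models T) {n : ℕ} {Γ : Fin n → L.Srt} (p : TypeSpace M.all Γ) :
    p.IsDefinable := by
  intro m Δ φ
  choose χ hχ using fun k : ℕ =>
    hT.exists_formulaOver_approx hM p φ (ε := (1 / 2) ^ (k + 2)) (by positivity)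
  exact ⟨χ, fun b => isForcedLim_of_abs_sub_le fun k => hχ k b⟩

/-! ### Small elementary substructures -/

/-- A closed set of elements which contains approximate witnesses for all formulae with
parameters in it. -/
structure Struct.Subset.IsSkolemClosed {L : Signature.{u}} {M : Struct L} (S : M.Subset) :
    Prop where
  closed : ∀ s, IsClosed (S s)
  witness : ∀ (n m : ℕ) (Γ : Fin n → L.Srt) (Δ : Fin m → L.Srt) (φ : Formula L (Sum.elim Γ Δ))
    (b : (j : Fin m) → S (Δ j)) (k : ℕ), ∃ a : (i : Fin n) → S (Γ i), ∀ a' : M.Tuple Γ,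
      φ.val M (M.join (fun i => (a i : M.Carrier (Γ i))) fun j => (b j : M.Carrier (Δ j))) ≤
        φ.val M (M.join a' fun j => (b j : M.Carrier (Δ j))) + (1 / 2) ^ k

theorem Struct.exists_near_min {L : Signature.{u}} (M : Struct L) {n m : ℕ} {Γ : Fin n → L.Srt}
    {Δ : Fin m → L.Srt} (φ : Formula L (Sum.elim Γ Δ)) (b : M.Tuple Δ) (k : ℕ) :
    ∃ a : M.Tuple Γ, ∀ a' : M.Tuple Γ,
      φ.val M (M.join a b) ≤ φ.val M (M.join a' b) + (1 / 2) ^ k := by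
  obtain ⟨a, ha⟩ := exists_lt_of_ciInf_lt (lt_add_of_pos_right
    (⨅ a : M.Tuple Γ, φ.val M (M.join a b)) (show (0 : ℝ) < (1 / 2) ^ k by positivity))
  refine ⟨a, fun a' => ha.le.trans (add_le_add_left ?_ _)⟩
  exact ciInf_le (f := fun a : M.Tuple Γ => φ.val M (M.join a b))
    ⟨0, by rintro _ ⟨a, rfl⟩; exact (φ.eval_mem _ _ _).1⟩ a'

/-- All formulae with two finite tuples of variables. -/
abbrev AllFormulas (L : Signature.{u}) : Type u :=
  Σ (n : ℕ) (m : ℕ) (Γ : Fin n → L.Srt) (Δ : Fin m → L.Srt), Formula L (Sum.elim Γ Δ)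

/-- Indices of the operations generating a Skolem closed set. -/
abbrev SkolemOp {L : Signature.{u}} {M : Struct L} (A : M.Subset) : Type u :=
  (Σ s, A s) ⊕ (Σ x : AllFormulas L, Fin x.1 × ℕ) ⊕ L.Srt

/-- The arities of the operations generating a Skolem closed set. -/
def SkolemOp.Arity {L : Signature.{u}} {M : Struct L} {A : M.Subset} : SkolemOp A → Type u
  | .inl _ => PEmpty
  | .inr (.inl x) => ULift (Fin x.1.2.1)
  | .inr (.inr _) => ULift ℕ

open Classical in
/-- The operations generating a Skolem closed set: the elements of `A`, approximate witnesses,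
and limits of sequences. -/
noncomputable def SkolemOp.interp {L : Signature.{u}} {M : Struct L} {A : M.Subset} :
    (Σ o : SkolemOp A, o.Arity → Σ s, M.Carrier s) → Σ s, M.Carrier s
  | ⟨.inl a, _⟩ => ⟨a.1, a.2⟩
  | ⟨.inr (.inl ⟨⟨_, _, Γ, Δ, φ⟩, i, k⟩), g⟩ =>
    -- Inputs range over the union of all sorts, so badly sorted inputs receive an arbitrary value.
    -- The index `i` selects one coordinate of the witness.
    if h : ∃ b : M.Tuple Δ, ∀ j, g ⟨j⟩ = ⟨Δ j, b j⟩ then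
      ⟨Γ i, (M.exists_near_min φ h.choose k).choose i⟩
    else ⟨Γ i, Classical.arbitrary _⟩
  | ⟨.inr (.inr s), g⟩ =>
    if h : ∃ x : M.Carrier s, ∃ y : ℕ → M.Carrier s, (∀ k, g ⟨k⟩ = ⟨s, y k⟩) ∧
        Filter.Tendsto y Filter.atTop (𝓝 x) then ⟨s, h.choose⟩
    else ⟨s, Classical.arbitrary _⟩

/-- The Skolem closed set generated by `A`. -/
def Struct.Subset.hull {L : Signature.{u}} {M : Struct L} (A : M.Subset) : M.Subset :=
  fun s => {x | (⟨s, x⟩ : Σ s, M.Carrier s) ∈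
    Set.range (WType.elim (β := SkolemOp.Arity (A := A)) _ SkolemOp.interp)}

theorem Struct.Subset.subset_hull {L : Signature.{u}} {M : Struct L} (A : M.Subset) (s : L.Srt) :
    A s ⊆ A.hull s := fun x hx =>
  ⟨.mk (.inl ⟨s, x, hx⟩) fun i => i.elim, rfl⟩

theorem Struct.Subset.isSkolemClosed_hull {L : Signature.{u}} {M : Struct L} (A : M.Subset) :
    A.hull.IsSkolemClosed where
  closed s := by
    refine IsSeqClosed.isClosed fun y x hy hx => ?_
    choose w hw using hy
    have h : ∃ x : M.Carrier s, ∃ y : ℕ → M.Carrier s,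
        (∀ k, WType.elim _ SkolemOp.interp (w k) = ⟨s, y k⟩) ∧
          Filter.Tendsto y Filter.atTop (𝓝 x) := ⟨x, y, hw, hx⟩
    refine ⟨.mk (.inr (.inr s)) fun k => w k.down, ?_⟩
    have h1 : WType.elim (β := SkolemOp.Arity (A := A)) _ SkolemOp.interp
        (.mk (.inr (.inr s)) fun k => w k.down) = ⟨s, h.choose⟩ := dif_pos h
    rw [h1]
    obtain ⟨y', hy', hx'⟩ := h.choose_spec
    have h2 : y' = y := funext fun k => by
      have := (hy' k).symm.trans (hw k)
      simpa using this
    exact congrArg _ (tendsto_nhds_unique (h2 ▸ hx' : Filter.Tendsto y _ _) hx)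
  witness n m Γ Δ φ b k := by
    choose w hw using fun j => (b j).2
    have h : ∃ b : M.Tuple Δ, ∀ j, WType.elim _ SkolemOp.interp (w j) = ⟨Δ j, b j⟩ :=
      ⟨fun j => b j, hw⟩
    have hb : h.choose = fun j => (b j : M.Carrier (Δ j)) := funext fun j => by
      have := (h.choose_spec j).symm.trans (hw j)
      simpa using this
    refine ⟨fun i => ⟨(M.exists_near_min φ h.choose k).choose i,
      .mk (.inr (.inl ⟨⟨n, m, Γ, Δ, φ⟩, i, k⟩)) fun j => w j.down, dif_pos h⟩, ?_⟩
    have := (M.exists_near_min φ h.choose k).choose_spec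
    rw [← hb]
    exact this

/-! ### The size of the Skolem hull -/

theorem mk_allFormulas_le {L : Signature.{u}} (T : Theory L) : #(AllFormulas L) ≤ T.card :=
  le_max_right _ _

theorem Theory.aleph0_le_card {L : Signature.{u}} (T : Theory L) : ℵ₀ ≤ T.card :=
  le_max_left _ _

theorem mk_srt_le {L : Signature.{u}} : #L.Srt ≤ #(AllFormulas L) := by
  classical
  let σ : L.Srt → Fin 1 ⊕ Fin 0 → L.Srt := fun s =>
    Sum.elim (fun _ : Fin 1 => s) fun i : Fin 0 => (i.elim0 : L.Srt)
  let x : ∀ s, Term L (Sum.elim (σ s) fun i : Fin 0 => (i.elim0 : L.Srt)) s := fun s =>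
    .var (σ := Sum.elim (σ s) fun i : Fin 0 => (i.elim0 : L.Srt)) (.inl (.inl 0))
  refine Cardinal.mk_le_of_injective
    (f := fun s => (⟨1, 0, fun _ => s, fun i => i.elim0, .dist s (x s) (x s)⟩ : AllFormulas L))
    fun s s' h => ?_
  have := congrArg (fun y : AllFormulas L => if h : 0 < y.1 then some (y.2.2.1 ⟨0, h⟩) else none) h
  simpa using this

theorem mk_skolemOp_le {L : Signature.{u}} {M : Struct L} {T : Theory L} {A : M.Subset}
    {κ : Cardinal.{u}} (hT : T.card ≤ κ) (hA : #(Σ s, A s) ≤ κ) : #(SkolemOp A) ≤ κ := by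
  have hκ : ℵ₀ ≤ κ := T.aleph0_le_card.trans hT
  have hF : #(AllFormulas L) ≤ κ := (mk_allFormulas_le T).trans hT
  have h1 : #(Σ x : AllFormulas L, Fin x.1 × ℕ) ≤ κ := by
    refine (Cardinal.mk_le_of_injective
      (f := fun x : Σ x : AllFormulas L, Fin x.1 × ℕ =>
        (x.1, ULift.up.{u} ((x.2.1 : ℕ), x.2.2))) ?_).trans ?_
    · rintro ⟨x, i, k⟩ ⟨x', i', k'⟩ h
      simp only [Prod.mk.injEq, ULift.up.injEq] at h
      obtain ⟨rfl, hi, rfl⟩ := h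
      rw [Fin.ext hi]
    · rw [Cardinal.mk_prod, Cardinal.lift_id, Cardinal.lift_id]
      exact Cardinal.mul_le_of_le hκ hF (by simpa using hκ)
  rw [Cardinal.mk_sum, Cardinal.lift_id, Cardinal.lift_id, Cardinal.mk_sum, Cardinal.lift_id,
    Cardinal.lift_id]
  exact Cardinal.add_le_of_le hκ hA (Cardinal.add_le_of_le hκ h1 (mk_srt_le.trans hF))

/-- Elements of the hull are values of well-founded trees with at most `κ` labels and countable
branching. The condition `κ ^ ℵ₀ ≤ κ` pays for the limits of sequences. -/
theorem mk_hull_le {L : Signature.{u}} {M : Struct L} {T : Theory L} {A : M.Subset}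
    {κ : Cardinal.{u}} (hT : T.card ≤ κ) (hκ : κ ^ ℵ₀ ≤ κ) (hA : #(Σ s, A s) ≤ κ) :
    #(Σ s, A.hull s) ≤ κ := by
  have hκ0 : ℵ₀ ≤ κ := T.aleph0_le_card.trans hT
  have h1 : #(WType (SkolemOp.Arity (A := A))) ≤ κ := by
    refine WType.cardinalMk_le_of_le ?_
    calc Cardinal.sum (fun o : SkolemOp A => κ ^ #o.Arity)
        ≤ Cardinal.sum fun _ : SkolemOp A => κ := by
          refine Cardinal.sum_le_sum _ _ fun o => ?_
          refine (Cardinal.power_le_power_left (Cardinal.aleph0_pos.trans_le hκ0).ne' ?_).trans hκ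
          rcases o with a | x | s
          · simp [SkolemOp.Arity]
          · simp [SkolemOp.Arity]
          · simp [SkolemOp.Arity]
      _ ≤ κ := by
        rw [Cardinal.sum_const']
        exact Cardinal.mul_le_of_le hκ0 (mk_skolemOp_le hT hA) le_rfl
  refine le_trans ?_ ((Cardinal.mk_range_le
    (f := WType.elim (β := SkolemOp.Arity (A := A)) _ SkolemOp.interp)).trans h1)
  refine Cardinal.mk_le_of_injective (f := fun x : Σ s, A.hull s => ⟨⟨x.1, x.2.1⟩, x.2.2⟩) ?_
  rintro ⟨s, x, hx⟩ ⟨s', x', hx'⟩ h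
  cases h
  rfl

/-! ### Skolem closed sets as elementary substructures -/

theorem Struct.Subset.IsSkolemClosed.fn_mem {L : Signature.{u}} {M : Struct L} {S : M.Subset}
    (hS : S.IsSkolemClosed) (f : L.Fn) (b : (i : Fin (L.fnArity f)) → S (L.fnDom f i)) :
    M.fn f (fun i => (b i : M.Carrier (L.fnDom f i))) ∈ S (L.fnCod f) := by
  rw [← (hS.closed (L.fnCod f)).closure_eq, Metric.mem_closure_iff]
  intro ε hε
  obtain ⟨k, hk⟩ := exists_pow_lt_of_lt_one hε (by norm_num : (1 / 2 : ℝ) < 1)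
  let σ : (Fin 1 ⊕ Fin (L.fnArity f)) ⊕ Fin 0 → L.Srt :=
    Sum.elim (Sum.elim (fun _ : Fin 1 => L.fnCod f) (L.fnDom f)) fun i => i.elim0
  -- Approximate minimisers of the distance to `f(b)` lie in `S` and come arbitrarily close to
  -- `f(b)`; then `S` is closed.
  let φ : Formula L (Sum.elim (fun _ : Fin 1 => L.fnCod f) (L.fnDom f)) :=
    .dist (L.fnCod f) (.app f fun i => .var (σ := σ) (.inl (.inr i)))
      (.var (σ := σ) (.inl (.inl 0)))
  obtain ⟨a, ha⟩ := hS.witness _ _ _ _ φ b k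
  refine ⟨a 0, (a 0).2, lt_of_le_of_lt ?_ hk⟩
  have h1 : dist (M.fn f fun i => (b i : M.Carrier (L.fnDom f i))) (a 0 : M.Carrier (L.fnCod f)) ≤
    dist (M.fn f fun i => (b i : M.Carrier (L.fnDom f i)))
      (M.fn f fun i => (b i : M.Carrier (L.fnDom f i))) + (1 / 2) ^ k :=
    ha fun _ => M.fn f fun i => b i
  simpa using h1

theorem Struct.Subset.IsSkolemClosed.nonempty {L : Signature.{u}} {M : Struct L} {S : M.Subset}
    (hS : S.IsSkolemClosed) (s : L.Srt) : Nonempty (S s) := by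
  let σ : (Fin 1 ⊕ Fin 0) ⊕ Fin 0 → L.Srt :=
    Sum.elim (Sum.elim (fun _ : Fin 1 => s) fun i => i.elim0) fun i => i.elim0
  obtain ⟨a, -⟩ := hS.witness 1 0 (fun _ => s) (fun i => i.elim0)
    (.dist s (.var (σ := σ) (.inl (.inl 0))) (.var (σ := σ) (.inl (.inl 0))))
    (fun i => i.elim0) 0
  exact ⟨a 0⟩

/-- A Skolem closed set, as a structure. -/
def Struct.Subset.IsSkolemClosed.toStruct {L : Signature.{u}} {M : Struct L} {S : M.Subset}
    (hS : S.IsSkolemClosed) : Struct L where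
  Carrier s := S s
  complete s := (hS.closed s).completeSpace_coe
  nonempty := hS.nonempty
  dist_le_one s x y := M.dist_le_one s x y
  fn f a := ⟨M.fn f fun i => (a i : M.Carrier (L.fnDom f i)), hS.fn_mem f a⟩
  pr P a := M.pr P fun i => (a i : M.Carrier (L.prDom P i))
  pr_mem P _ := M.pr_mem P _
  fn_unif f i ε hε _ _ h hd :=
    M.fn_unif f i ε hε _ _ (fun j hj => congrArg Subtype.val (h j hj)) hd
  pr_unif P i ε hε _ _ h hd :=
    M.pr_unif P i ε hε _ _ (fun j hj => congrArg Subtype.val (h j hj)) hd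
  dist_unif_left s ε hε x y z := M.dist_unif_left s ε hε x y z
  dist_unif_right s ε hε x y z := M.dist_unif_right s ε hε x y z

/-- The inclusion of a Skolem closed set, on tuples. -/
def Struct.Subset.IsSkolemClosed.incl {L : Signature.{u}} {M : Struct L} {S : M.Subset}
    (hS : S.IsSkolemClosed) {α : Type*} {σ : α → L.Srt} (v : hS.toStruct.Tuple σ) : M.Tuple σ :=
  fun a => (v a).1

theorem Struct.Subset.IsSkolemClosed.incl_join {L : Signature.{u}} {M : Struct L} {S : M.Subset}
    (hS : S.IsSkolemClosed) {α β : Type*} {σ : α → L.Srt} {τ : β → L.Srt}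
    (v : hS.toStruct.Tuple σ) (w : hS.toStruct.Tuple τ) :
    hS.incl (hS.toStruct.join v w) = M.join (hS.incl v) (hS.incl w) := by
  funext x
  rcases x with a | b <;> rfl

theorem Struct.Subset.IsSkolemClosed.incl_cons {L : Signature.{u}} {M : Struct L} {S : M.Subset}
    (hS : S.IsSkolemClosed) {n : ℕ} {Γ : Fin n → L.Srt} {s : L.Srt} (b : S s)
    (w : hS.toStruct.Tuple Γ) :
    hS.incl (hS.toStruct.cons b w) = M.cons (b : M.Carrier s) (hS.incl w) := by
  funext x
  induction x using Fin.cases <;> rfl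

theorem Struct.Subset.IsSkolemClosed.eval_term {L : Signature.{u}} {M : Struct L} {S : M.Subset}
    (hS : S.IsSkolemClosed) {α : Type*} {σ : α → L.Srt} (v : hS.toStruct.Tuple σ) {s : L.Srt}
    (t : Term L σ s) : (t.eval hS.toStruct v).1 = t.eval M (hS.incl v) := by
  induction t with
  | var a => rfl
  | app f ts ih =>
    simp only [Term.eval, ← ih]
    rfl

/-- The Tarski–Vaught condition for one quantifier. Here both the free variables and the outer bound
ones act as parameters, and finite support reduces them to a finite tuple. -/
theorem Struct.Subset.IsSkolemClosed.exists_witness {L : Signature.{u}} {M : Struct L}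
    {S : M.Subset} (hS : S.IsSkolemClosed) {α : Type*} {σ : α → L.Srt} {n : ℕ}
    {Γ : Fin n → L.Srt} {s : L.Srt}
    (φ : BFormula L σ (n + 1) (Fin.cons s Γ : Fin (n + 1) → L.Srt)) (v : hS.toStruct.Tuple σ)
    (w : hS.toStruct.Tuple Γ) {ε : ℝ} (hε : 0 < ε) :
    ∃ b : S s, ∀ b' : M.Carrier s, φ.eval M (hS.incl v) (M.cons (b : M.Carrier s) (hS.incl w)) ≤
      φ.eval M (hS.incl v) (M.cons b' (hS.incl w)) + ε := by
  let τ : (α ⊕ Fin n) ⊕ Fin 1 → L.Srt := Sum.elim (Sum.elim σ Γ) fun _ : Fin 1 => s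
  let ρ : ∀ x, Term L τ (Sum.elim σ (Fin.cons s Γ : Fin (n + 1) → L.Srt) x) := fun
    | .inl a => .var (σ := τ) (.inl (.inl a))
    | .inr i => Fin.cases
        (motive := fun i => Term L τ ((Fin.cons s Γ : Fin (n + 1) → L.Srt) i))
        (Term.var (σ := τ) (.inr 0)) (fun i => Term.var (σ := τ) (.inl (.inr i))) i
  have h1 : ∀ b : Fin 1 → M.Carrier s,
      (φ.subst ρ).eval M (M.join (hS.incl v) (hS.incl w)) (fun i : Fin 1 => b i) =
        φ.eval M (hS.incl v) (M.cons (b 0) (hS.incl w)) := by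
    intro b
    refine BFormula.eval_subst M φ ρ ?_
    rintro (a | i)
    · rfl
    · induction i using Fin.cases <;> rfl
  obtain ⟨m, e, χ, hχ⟩ := (φ.subst ρ).exists_fin
  obtain ⟨k, hk⟩ := exists_pow_lt_of_lt_one hε (by norm_num : (1 / 2 : ℝ) < 1)
  obtain ⟨a, ha⟩ := hS.witness _ _ _ _ χ.free (fun j => hS.toStruct.join v w (e j)) k
  refine ⟨a 0, fun b' => ?_⟩
  have h2 : ∀ b : Fin 1 → M.Carrier s, χ.free.val M (M.join (fun i : Fin 1 => b i)
      fun j => hS.incl (hS.toStruct.join v w) (e j)) =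
        φ.eval M (hS.incl v) (M.cons (b 0) (hS.incl w)) := by
    intro b
    rw [BFormula.val_free, hS.incl_join, ← h1]
    exact hχ M _ _
  have h3 := ha fun _ => b'
  have h4 := h2 fun i => (a i).1
  have h5 := h2 fun _ => b'
  have h6 : φ.eval M (hS.incl v) (M.cons (a 0 : M.Carrier s) (hS.incl w)) ≤
      φ.eval M (hS.incl v) (M.cons b' (hS.incl w)) + (1 / 2) ^ k := by
    rw [← h4, ← h5]
    exact h3
  exact h6.trans (by linarith)

/-- Skolem closed sets are elementary substructures. -/
theorem Struct.Subset.IsSkolemClosed.eval_eq {L : Signature.{u}} {M : Struct L} {S : M.Subset}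
    (hS : S.IsSkolemClosed) {α : Type*} {σ : α → L.Srt} {n : ℕ} {Γ : Fin n → L.Srt}
    (φ : BFormula L σ n Γ) (v : hS.toStruct.Tuple σ) (w : hS.toStruct.Tuple Γ) :
    φ.eval hS.toStruct v w = φ.eval M (hS.incl v) (hS.incl w) := by
  have hinf : ∀ {n : ℕ} {Γ : Fin n → L.Srt} (s : L.Srt)
      (φ : BFormula L σ (n + 1) (Fin.cons s Γ : Fin (n + 1) → L.Srt)),
      (∀ w : hS.toStruct.Tuple (Fin.cons s Γ : Fin (n + 1) → L.Srt),
        φ.eval hS.toStruct v w = φ.eval M (hS.incl v) (hS.incl w)) →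
      ∀ w : hS.toStruct.Tuple Γ, (BFormula.inf s φ).eval hS.toStruct v w =
        (BFormula.inf s φ).eval M (hS.incl v) (hS.incl w) := by
    intro n Γ s φ ih w
    simp only [BFormula.eval, ih]
    refine le_antisymm (le_ciInf fun b' => le_of_forall_pos_le_add fun ε hε => ?_)
      (le_ciInf fun b => ?_)
    · obtain ⟨b, hb⟩ := hS.exists_witness φ v w hε
      refine (ciInf_le ⟨0, ?_⟩ (b : hS.toStruct.Carrier s)).trans ?_
      · rintro _ ⟨b, rfl⟩
        exact (φ.eval_mem _ _ _).1
      · exact (congrArg (φ.eval M (hS.incl v)) (hS.incl_cons b w)).le.trans (hb b')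
    · refine (ciInf_le ⟨0, ?_⟩ (b.1 : M.Carrier s)).trans
        (congrArg (φ.eval M (hS.incl v)) (hS.incl_cons b w)).ge
      rintro _ ⟨b, rfl⟩
      exact (φ.eval_mem _ _ _).1
  induction φ with
  | dist s t₁ t₂ =>
    simp only [BFormula.eval, ← hS.incl_join, ← hS.eval_term]
    rfl
  | pred P ts =>
    simp only [BFormula.eval, ← hS.incl_join, ← hS.eval_term]
    rfl
  | neg φ ih => simp only [BFormula.eval, ih]
  | half φ ih => simp only [BFormula.eval, ih]
  | dotminus φ ψ ih₁ ih₂ => simp only [BFormula.eval, ih₁, ih₂]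
  | inf s φ ih => exact hinf s φ ih w
  | sup s φ ih =>
    simp only [BFormula.eval_sup]
    exact congrArg (1 - ·) (hinf s (.neg φ) (fun w => congrArg (1 - ·) (ih w)) w)

theorem Struct.Subset.IsSkolemClosed.val_eq {L : Signature.{u}} {M : Struct L} {S : M.Subset}
    (hS : S.IsSkolemClosed) {α : Type*} {σ : α → L.Srt} (φ : Formula L σ)
    (v : hS.toStruct.Tuple σ) : φ.val hS.toStruct v = φ.val M (hS.incl v) := by
  rw [Formula.val, hS.eval_eq]
  exact congrArg (BFormula.eval M _ φ) (funext fun i => i.elim0)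

theorem Struct.Subset.IsSkolemClosed.models {L : Signature.{u}} {M : Struct L} {S : M.Subset}
    (hS : S.IsSkolemClosed) {T : Theory L} (hM : M.Models T) : hS.toStruct.Models T := by
  intro φ hφ
  rw [hS.val_eq, ← hM φ hφ]
  exact congrArg (Formula.val M φ) (funext fun i => i.elim0)

/-! ### Counting types -/

/-- A Skolem closed set containing `A`, as a model of `T(A)`. -/
def Struct.Subset.IsSkolemClosed.modelOver {L : Signature.{u}} {M : Struct L} {S A : M.Subset}
    (hS : S.IsSkolemClosed) (hA : ∀ s, A s ⊆ S s) : ModelOver A where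
  N := hS.toStruct
  c s x := ⟨x.1, hA s x.2⟩
  val_eq _ _ φ _ := hS.val_eq φ _

/-- A formula over `A`, as a formula over a Skolem closed set containing `A`. -/
def Struct.Subset.IsSkolemClosed.liftFormula {L : Signature.{u}} {M : Struct L} {S A : M.Subset}
    (hS : S.IsSkolemClosed) (hA : ∀ s, A s ⊆ S s) {n : ℕ} {Γ : Fin n → L.Srt}
    (ψ : FormulaOver A Γ) : FormulaOver hS.toStruct.all Γ :=
  ⟨ψ.m, ψ.Δ, ψ.φ, fun j => ⟨⟨(ψ.b j).1, hA _ (ψ.b j).2⟩, Set.mem_univ _⟩⟩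

/-- The type `p` is a limit of types of tuples from the substructure. The limit of their types over
the whole substructure, along the same ultrafilter, is an extension. -/
theorem TypeSpace.exists_extension {L : Signature.{u}} {M : Struct L} {S A : M.Subset}
    (hS : S.IsSkolemClosed) (hA : ∀ s, A s ⊆ S s) {n : ℕ} {Γ : Fin n → L.Srt}
    (p : TypeSpace A Γ) :
    ∃ q : TypeSpace hS.toStruct.all Γ, ∀ ψ, p.1 ψ = q.1 (hS.liftFormula hA ψ) := by
  obtain ⟨U, hU⟩ := p.exists_ultrafilter (hS.modelOver hA)
  exact ⟨((ModelOver.self hS.toStruct.all).upow U).typeOf (utup U id), fun ψ =>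
    tendsto_nhds_unique (hU ψ)
      ((ModelOver.self hS.toStruct.all).tendsto_val_upow U (hS.liftFormula hA ψ) id)⟩

theorem mk_formulaOver_le {L : Signature.{u}} {T : Theory L} {M : Struct L} {A : M.Subset}
    {κ : Cardinal.{u}} (hT : T.card ≤ κ) (hA : #(Σ s, A s) ≤ κ) {n : ℕ} (Γ : Fin n → L.Srt) :
    #(FormulaOver A Γ) ≤ κ := by
  have hκ : ℵ₀ ≤ κ := T.aleph0_le_card.trans hT
  have h1 := Cardinal.mk_le_of_injective (f := fun ψ : FormulaOver A Γ =>
    ((⟨n, ψ.m, Γ, ψ.Δ, ψ.φ⟩ : AllFormulas L),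
      List.ofFn fun j => (⟨ψ.Δ j, ψ.b j⟩ : Σ s, A s))) (by
    rintro ⟨m, Δ, φ, b⟩ ⟨m', Δ', φ', b'⟩ h
    obtain ⟨h1, h2⟩ := Prod.mk.inj h
    cases h1
    have h3 := List.ofFn_injective h2
    have : b = b' := funext fun j => by simpa using congrFun h3 j
    rw [this])
  refine h1.trans ?_
  rw [Cardinal.mk_prod, Cardinal.lift_id, Cardinal.lift_id]
  exact Cardinal.mul_le_of_le hκ ((mk_allFormulas_le T).trans hT)
    ((Cardinal.mk_list_le_max _).trans (max_le hκ hA))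

/-- A type is recovered from its defining sequences by uniqueness of forced limits. Each of at most
`|T|` formulae has at most `κ ^ ℵ₀ ≤ κ` possible sequences, which leaves at most `κ ^ |T| ≤ κ`
types. -/
theorem mk_typeSpace_le {L : Signature.{u}} {T : Theory L} {M : Struct L} {κ : Cardinal.{u}}
    (hT : T.card ≤ κ) (hκ : κ ^ ℵ₀ ≤ κ) (hκT : κ ^ T.card ≤ κ)
    (hM : #(Σ s, M.all s) ≤ κ) {n : ℕ} (Γ : Fin n → L.Srt)
    (hdef : ∀ p : TypeSpace M.all Γ, p.IsDefinable) : #(TypeSpace M.all Γ) ≤ κ := by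
  have hκ0 : κ ≠ 0 := (Cardinal.aleph0_pos.trans_le (T.aleph0_le_card.trans hT)).ne'
  choose χ hχ using hdef
  let F := Σ (m : ℕ) (Δ : Fin m → L.Srt), Formula L (Sum.elim Γ Δ)
  have hF : #F ≤ T.card := by
    refine le_trans ?_ (mk_allFormulas_le T)
    refine Cardinal.mk_le_of_injective
      (f := fun x : F => (⟨n, x.1, Γ, x.2.1, x.2.2⟩ : AllFormulas L)) ?_
    rintro ⟨m, Δ, φ⟩ ⟨m', Δ', φ'⟩ h
    cases h
    rfl
  have h1 := Cardinal.mk_le_of_injective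
    (f := fun (p : TypeSpace M.all Γ) (x : F) => χ p x.1 x.2.1 x.2.2) (by
    intro p q h
    refine Subtype.ext (funext fun ψ => ?_)
    have h2 := hχ p ψ.m ψ.Δ ψ.φ fun j => (ψ.b j).1
    have h3 := hχ q ψ.m ψ.Δ ψ.φ fun j => (ψ.b j).1
    have h4 : χ p ψ.m ψ.Δ ψ.φ = χ q ψ.m ψ.Δ ψ.φ := congrFun h ⟨ψ.m, ψ.Δ, ψ.φ⟩
    rw [h4] at h2
    exact tendsto_nhds_unique h2 h3)
  refine h1.trans ?_
  rw [Cardinal.mk_pi]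
  calc Cardinal.prod (fun x : F => #(ℕ → FormulaOver M.all x.2.1))
      ≤ Cardinal.prod fun _ : F => κ := by
        refine Cardinal.prod_le_prod _ _ fun x => ?_
        have h2 : #(ℕ → FormulaOver M.all x.2.1) = #(FormulaOver M.all x.2.1) ^ ℵ₀ := by simp
        rw [h2]
        exact (Cardinal.power_le_power_right (mk_formulaOver_le hT hM _)).trans hκ
    _ = κ ^ #F := by simp
    _ ≤ κ ^ T.card := Cardinal.power_le_power_left hκ0 hF
    _ ≤ κ := hκT

theorem isCardStable_of_isDefinable {L : Signature.{u}} {T : Theory L}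
    (h : ∀ M : Struct L, M.Models T → ∀ (n : ℕ) (Γ : Fin n → L.Srt)
      (p : TypeSpace M.all Γ), p.IsDefinable)
    {κ : Cardinal.{u}} (hκ : ℵ₀ ≤ κ) (hκT : κ = κ ^ T.card) : T.IsCardStable κ := by
  intro M hM A hA n Γ
  have hκ0 : κ ≠ 0 := (Cardinal.aleph0_pos.trans_le hκ).ne'
  have h2 : 2 ≤ κ := (Cardinal.natCast_lt_aleph0 (n := 2)).le.trans hκ
  -- By Cantor, `|T| < 2 ^ |T| ≤ κ ^ |T| = κ`.
  have hT : T.card ≤ κ := by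
    rw [hκT]
    exact (Cardinal.cantor _).le.trans (Cardinal.power_le_power_right h2)
  have hκω : κ ^ ℵ₀ ≤ κ :=
    (Cardinal.power_le_power_left hκ0 T.aleph0_le_card).trans hκT.ge
  have hS := A.isSkolemClosed_hull
  have hN : #(Σ s, hS.toStruct.all s) ≤ κ := by
    refine le_trans ?_ (mk_hull_le hT hκω hA)
    refine Cardinal.mk_le_of_injective
      (f := fun x : Σ s, hS.toStruct.all s => (⟨x.1, x.2.1⟩ : Σ s, A.hull s)) ?_
    rintro ⟨s, x, hx⟩ ⟨s', x', hx'⟩ h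
    cases h
    rfl
  refine (TypeSpace.densityCharacter_le_mk A Γ).trans (le_trans ?_
    (mk_typeSpace_le hT hκω hκT.ge hN Γ (h _ (hS.models hM) n Γ)))
  choose q hq using fun p : TypeSpace A Γ => p.exists_extension hS A.subset_hull
  refine Cardinal.mk_le_of_injective (f := q) fun p p' hpp => Subtype.ext (funext fun ψ => ?_)
  rw [hq, hq, hpp]

end ContLogic

/-! ### The equivalence -/

theorem mainTheorem1 {L : ContLogic.Signature.{u}} (T : ContLogic.Theory L) :
    List.TFAE [
      T.IsStable,
      ∀ M : ContLogic.Struct L, M.Models T → ∀ (n : ℕ) (Γ : Fin n → L.Srt)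
        (p : ContLogic.TypeSpace M.all Γ), p.IsDefinable,
      ∀ κ : Cardinal.{u}, Cardinal.aleph0 ≤ κ → κ = κ ^ ContLogic.Theory.card T →
        T.IsCardStable κ,
      ∃ κ : Cardinal.{u}, ContLogic.Theory.card T ≤ κ ∧ T.IsCardStable κ] := by
  tfae_have 1 → 2 := fun h M hM n Γ p => h.isDefinable hM p
  tfae_have 2 → 3 := fun h κ hκ hκT => ContLogic.isCardStable_of_isDefinable h hκ hκT
  tfae_have 3 → 4 := fun h => by
    have hT := T.aleph0_le_card
    -- This cardinal is fixed by the power `|T|`, because `|T| * |T| = |T|`.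
    refine ⟨2 ^ T.card, (Cardinal.cantor _).le, h _ (hT.trans (Cardinal.cantor _).le) ?_⟩
    rw [← Cardinal.power_mul, Cardinal.mul_eq_self hT]
  tfae_have 4 → 1 := fun ⟨κ, hκ, h⟩ => h.isStable (T.aleph0_le_card.trans hκ)
  tfae_finish
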